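/- Let $(X_{i,n})_{1\le i\le n,\ n\in\mathbb N}$ be a triangular array of real random variables such that, for each $n$, the variables $X_{1,n},\dots,X_{n,n}$ are independent and centered, and each $X_{i,n}$ has a probability density function $f_{i,n}$ with respect to Lebesgue measure on $\mathbb R$. Assume: 1. There are $r\in(1,2]$ and $M>0$ (independent of $i,n$) such that $\sup_{i,n}\|f_{i,n}\|_{L^r(\mathbb R)}\le M$. 2. $\sigma_{i,n}^2:=\mathrm{Var}[X_{i,n}]<\infty$ for all $i\le n$, and $\sigma_{1,n}^2\ge\dots\ge\sigma_{n,n}^2$ for every $n$. Put $s_n:=\big(\sum_{i=1}^n\sigma_{i,n}^2\big)^{1/2}$. 3. (Lindeberg's condition) For every $\varepsilon>0$, $$\frac{1}{s_n^2}\sum_{i=1}^n \mathbb E\big[X_{i,n}^2\mathbf 1_{\{|X_{i,n}|>\varepsilon s_n\}}\big]\xrightarrow[n\to\infty]{}0 .$$ 4. There exist $\delta>0$ independent of $n$, real numbers $K(n)$ and integers $l_*(n)$, $l^*(n)$ such that, for all sufficiently large $n$, $K(n)\ge1$, $l_*(n)\ge1$, $n\ge l^*(n)\ge 2\lceil \frac{r}{r-1}\rceil$,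 and $$\text{(a)}\quad \frac{\sum_{i=l_*(n)}^n\sigma_{i,n}^2}{\sum_{i=1}^n\sigma_{i,n}^2}\ge\delta;\qquad \text{(b)}\quad \frac{\sum_{i=l_*(n)}^n\mathbb E\big[X_{i,n}^2\mathbf 1_{\{|X_{i,n}|>K(n)\}}\big]}{\sum_{i=l_*(n)}^n\sigma_{i,n}^2}\le\frac18;$$ and moreover, as $n\to\infty$, $$\text{(c)}\quad \log(s_n^2)=o\!\left(\frac{n-l^*(n)}{\max\{\sigma_{l^*(n),n}^2,\,K(n)^2\}}\right).$$ Let $f^{(n)}:=f_{1,n}*\cdots*f_{n,n}$ be the convolution of the densities. Then, for every $n\ge1$, $f^{(n)}$ is a density of $\sum_{i=1}^nX_{i,n}$ and $x\mapsto s_nf^{(n)}(s_nx)$ is a density of $\frac1{s_n}\sum_{i=1}^nX_{i,n}$, and $$s_nf^{(n)}(s_nx)\xrightarrow[n\to\infty]{}\frac{1}{\sqrt{2\pi}}e^{-x^2/2}\qquad\text{uniformly over }x\in\mathbb R .$$ -/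

import Mathlib

open MeasureTheory ProbabilityTheory Filter Topology Asymptotics

noncomputable section

/-- `g` is a probability density function of the random variable `Y` under `P`, with respect to
Lebesgue measure on `ℝ`. -/
def IsDensityOf {Ω : Type*} [MeasurableSpace Ω] (P : Measure Ω) (Y : Ω → ℝ) (g : ℝ → ℝ) : Prop :=
  Measurable g ∧ (∀ x, 0 ≤ g x) ∧
    P.map Y = (volume : Measure ℝ).withDensity (fun x => ENNReal.ofReal (g x))

/-- The iterated convolution `g 1 ⋆ g 2 ⋆ ⋯ ⋆ g n` on `ℝ` with Lebesgue measure
(only meaningful for `n ≥ 1`). -/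
def iterConv (g : ℕ → ℝ → ℝ) : ℕ → ℝ → ℝ
  | 0 => fun _ => 0
  | 1 => g 1
  | n + 2 => convolution (iterConv g (n + 1)) (g (n + 2)) (ContinuousLinearMap.lsmul ℝ ℝ) volume

/-- `s_n² = ∑_{i=1}^n Var[X_{i,n}]`. The entry `X_{i,n}` of the array is `X n i`. -/
def rowVar {Ω : ℕ → Type*} [∀ n, MeasurableSpace (Ω n)] (P : ∀ n, Measure (Ω n))
    (X : ∀ n, ℕ → Ω n → ℝ) (n : ℕ) : ℝ :=
  ∑ i ∈ Finset.Icc 1 n, variance (X n i) (P n)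

/-- `s_n`, the standard deviation of the `n`-th row sum. -/
def rowSD {Ω : ℕ → Type*} [∀ n, MeasurableSpace (Ω n)] (P : ∀ n, Measure (Ω n))
    (X : ∀ n, ℕ → Ω n → ℝ) (n : ℕ) : ℝ :=
  Real.sqrt (rowVar P X n)

/-- `E[Y² 1_{|Y| > c}]`. -/
def tailSecondMoment {Ω : Type*} [MeasurableSpace Ω] (P : Measure Ω) (Y : Ω → ℝ) (c : ℝ) : ℝ :=
  ∫ ω in {ω | c < |Y ω|}, Y ω ^ 2 ∂P

end

/-! The proof is Fourier inversion. Let `ψ n` be the characteristic function of the normalized row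
sum. Both the rescaled convolution and the Gaussian density are inverse Fourier integrals, so their
difference is bounded, uniformly in `x`, by the `L¹` distance between `ψ n` and `exp (-t²/2)`
(`mul_iterConv_eq_integral`, `enorm_sub_le_lintegral_of_eq_integral`). That distance tends to zero
for three reasons, assembled in `tendsto_lintegral_enorm_sub_exp`.

Pointwise convergence is the Lindeberg argument (`norm_prod_charFun_sub_exp_le`).

For `|t| ≤ s_n / K(n)`, truncation at `K(n)` in the block from `l_*` to `n`, which carries a share
`δ` of the variance, gives the dominating function `exp (-δt²/8)` (`norm_prod_charFun_le_exp`).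

For `|t| > s_n / K(n)`, the first `2⌈r/(r-1)⌉` factors have an integrable product, by Hölder and an
`L^p` bound on characteristic functions (`IsDensityOf.lintegral_norm_charFun_pow_le`). Each factor
beyond `l^*` is at most `1 - c/V`, where `V = max (σ², K²)` (`IsDensityOf.norm_charFun_le_one_sub`).
The tail is then at most a constant times `s_n exp (-c (n - l^*) / V)`, and condition (c) sends this
to zero.

The `L^r` bound enters only by preventing concentration: little mass lies where the density is
large, and a set of small Lebesgue measure has small probability. It also bounds the variances from
below, so `s_n` tends to infinity. -/

/-! ### Densities of sums and of rescaled variables. -/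

namespace IsDensityOf

variable {Ω : Type*} [MeasurableSpace Ω] {P : Measure Ω} {Y Z : Ω → ℝ} {g h : ℝ → ℝ}

lemma lintegral_eq_one [IsProbabilityMeasure P] (hY : Measurable Y) (hg : IsDensityOf P Y g) :
    ∫⁻ x, ENNReal.ofReal (g x) = 1 := by
  have : IsProbabilityMeasure (P.map Y) := Measure.isProbabilityMeasure_map hY.aemeasurable
  have h1 : (P.map Y) Set.univ = 1 := measure_univ
  rwa [hg.2.2, withDensity_apply _ MeasurableSet.univ, Measure.restrict_univ] at h1

lemma integrable [IsProbabilityMeasure P] (hY : Measurable Y) (hg : IsDensityOf P Y g) :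
    Integrable g := by
  refine ⟨hg.1.aestronglyMeasurable, ?_⟩
  rw [hasFiniteIntegral_iff_ofReal (ae_of_all _ hg.2.1), hg.lintegral_eq_one hY]
  exact ENNReal.one_lt_top

lemma integral_map {E : Type*} [NormedAddCommGroup E] [NormedSpace ℝ E]
    (hg : IsDensityOf P Y g) (φ : ℝ → E) :
    ∫ x, φ x ∂(P.map Y) = ∫ x, g x • φ x := by
  rw [hg.2.2, integral_withDensity_eq_integral_toReal_smul
    (hg.1.ennreal_ofReal) (ae_of_all _ fun _ => ENNReal.ofReal_lt_top)]
  simp_rw [ENNReal.toReal_ofReal (hg.2.1 _)]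

/-- The convolution of the densities of two independent variables is a density of their sum. -/
lemma convolution [IsProbabilityMeasure P] (hY : Measurable Y) (hZ : Measurable Z)
    (hg : IsDensityOf P Y g) (hh : IsDensityOf P Z h) (hYZ : IndepFun Y Z P) :
    IsDensityOf P (Y + Z)
      (MeasureTheory.convolution g h (ContinuousLinearMap.lsmul ℝ ℝ) volume) := by
  have hm : Measurable fun p : ℝ × ℝ => g p.2 * h (p.1 - p.2) := by
    have := hg.1; have := hh.1; fun_prop
  refine ⟨?_, fun x => ?_, ?_⟩
  · have := (hm.stronglyMeasurable.integral_prod_right' (ν := volume)).measurable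
    exact this
  · exact integral_nonneg fun t => mul_nonneg (hg.2.1 _) (hh.2.1 _)
  · rw [hYZ.map_add_eq_map_conv_map hY hZ, hg.2.2, hh.2.2,
      conv_withDensity_eq_lconvolution (by have := hg.1; fun_prop) (by have := hh.1; fun_prop)]
    refine withDensity_congr_ae ?_
    -- The Bochner convolution takes the default value zero where its integrand is not integrable.
    -- This happens only on a null set, so it still represents the law.
    filter_upwards [(hg.integrable hY).ae_convolution_exists
      (ContinuousLinearMap.lsmul ℝ ℝ) (hh.integrable hZ)] with x hx
    rw [convolution_def, ofReal_integral_eq_lintegral_ofReal hx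
      (ae_of_all _ fun t => mul_nonneg (hg.2.1 _) (hh.2.1 _)), lconvolution_def]
    refine lintegral_congr fun t => ?_
    simp only [ContinuousLinearMap.lsmul_apply, smul_eq_mul]
    rw [ENNReal.ofReal_mul (hg.2.1 _), neg_add_eq_sub]

/-- Density of a rescaled variable. -/
lemma div_const {s : ℝ} (hs : 0 < s) (hY : Measurable Y) (hg : IsDensityOf P Y g) :
    IsDensityOf P (fun ω => Y ω / s) (fun x => s * g (s * x)) := by
  refine ⟨(hg.1.comp (measurable_const_mul s)).const_mul s,
    fun x => mul_nonneg hs.le (hg.2.1 _), ?_⟩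
  have h1 : P.map (fun ω => Y ω / s) = (P.map Y).map (fun x => x / s) := by
    rw [Measure.map_map (by fun_prop) hY]; rfl
  rw [h1, hg.2.2]
  ext A hA
  have hmg : Measurable fun x => ENNReal.ofReal (g x) := ENNReal.measurable_ofReal.comp hg.1
  rw [Measure.map_apply (by fun_prop) hA, withDensity_apply _ hA,
    withDensity_apply _ (measurableSet_preimage (by fun_prop) hA)]
  rw [← lintegral_indicator hA, ← lintegral_indicator (measurableSet_preimage (by fun_prop) hA)]
  have h2 := Real.smul_map_volume_mul_left hs.ne'
  nth_rewrite 1 [← h2]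
  rw [lintegral_smul_measure, lintegral_map _ (by fun_prop)]
  · rw [smul_eq_mul, abs_of_pos hs, ← lintegral_const_mul]
    · refine lintegral_congr fun x => ?_
      have : x ∈ A ↔ s * x ∈ (fun x => x / s) ⁻¹' A := by
        simp [mul_div_cancel_left₀ _ hs.ne']
      by_cases hx : x ∈ A
      · rw [Set.indicator_of_mem hx, Set.indicator_of_mem (this.1 hx), ENNReal.ofReal_mul hs.le]
      · rw [Set.indicator_of_notMem hx, Set.indicator_of_notMem (mt this.2 hx), mul_zero]
    · exact (hmg.indicator (measurableSet_preimage (by fun_prop) hA)).comp (measurable_const_mul s)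
  · exact hmg.indicator (measurableSet_preimage (by fun_prop) hA)

end IsDensityOf

section PartialSums

variable {Ω : Type*} [MeasurableSpace Ω] {P : Measure Ω} [IsProbabilityMeasure P]
  {X : ℕ → Ω → ℝ} {f : ℕ → ℝ → ℝ} {n : ℕ}

/-- The iterated convolution of the densities is a density of the partial sum. -/
lemma isDensityOf_iterConv (hX : ∀ i ∈ Finset.Icc 1 n, Measurable (X i))
    (hind : iIndepFun (fun i : Finset.Icc 1 n => X i) P)
    (hf : ∀ i ∈ Finset.Icc 1 n, IsDensityOf P (X i) (f i)) {k : ℕ} (hk : 1 ≤ k) (hkn : k ≤ n) :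
    IsDensityOf P (fun ω => ∑ i ∈ Finset.Icc 1 k, X i ω) (iterConv f k) := by
  induction k, hk using Nat.le_induction with
  | base => simpa [iterConv] using hf 1 (by simp [hkn])
  | succ k hk ih =>
    obtain ⟨j, rfl⟩ : ∃ j, k = j + 1 := ⟨k - 1, by omega⟩
    have hmem : j + 2 ∈ Finset.Icc 1 n := by simp; omega
    have hsub : ∀ i ∈ Finset.Icc 1 (j + 1), i ∈ Finset.Icc 1 n := by
      intro i hi; simp at hi ⊢; omega
    have hS : Measurable fun ω => ∑ i ∈ Finset.Icc 1 (j + 1), X i ω :=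
      Finset.measurable_sum _ fun i hi => hX i (hsub i hi)
    have hI : IndepFun (fun ω => ∑ i ∈ Finset.Icc 1 (j + 1), X i ω) (X (j + 2)) P := by
      have := hind.indepFun_finsetSum_of_notMem (fun i => hX i.1 i.2)
        (s := Finset.univ.filter fun i => i.1 ∈ Finset.Icc 1 (j + 1)) (i := ⟨j + 2, hmem⟩) (by simp)
      convert this using 1
      ext ω
      rw [Finset.sum_apply]
      refine Finset.sum_bij' (fun i hi => ⟨i, hsub i hi⟩) (fun i _ => i.1) ?_ ?_ ?_ ?_ ?_ <;> simp
    have := (ih (by omega)).convolution hS (hX _ hmem) (hf _ hmem) hI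
    rw [show iterConv f (j + 1 + 1) = MeasureTheory.convolution (iterConv f (j + 1)) (f (j + 2))
      (ContinuousLinearMap.lsmul ℝ ℝ) volume from iterConv.eq_3 f j]
    convert this using 1
    ext ω
    rw [Finset.sum_Icc_succ_top (by omega)]
    rfl

end PartialSums

/-! ### Fourier inversion for densities. -/

section FourierInversion

open scoped FourierTransform

/-- The inverse transform is the general Fourier integral for the pairing `-innerₗ ℝ`, which is
symmetric; the rest is Fubini. -/
lemma integral_fourierInv_mul_eq_flip {u v : ℝ → ℂ} (hu : Integrable u) (hv : Integrable v) :
    ∫ x, 𝓕⁻ u x * v x = ∫ x, u x * 𝓕⁻ v x := by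
  have h := VectorFourier.integral_fourierIntegral_smul_eq_flip (L := -innerₗ ℝ)
    Real.continuous_fourierChar (by exact continuous_inner.neg) hu hv
  have hflip : (-innerₗ ℝ).flip = (-innerₗ ℝ : ℝ →ₗ[ℝ] ℝ →ₗ[ℝ] ℝ) := by
    ext; simp
  rw [hflip] at h
  exact h

/-- Fourier inversion almost everywhere for integrable functions with integrable Fourier
transform. -/
lemma fourierInv_fourier_ae_eq {h : ℝ → ℂ} (hh : Integrable h) (hF : Integrable (𝓕 h)) :
    ∀ᵐ x, 𝓕⁻ (𝓕 h) x = h x := by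
  have hcont : Continuous (𝓕⁻ (𝓕 h)) :=
    VectorFourier.fourierIntegral_continuous (L := -innerₗ ℝ) Real.continuous_fourierChar
      (by exact continuous_inner.neg) hF
  -- As `h` need not be continuous, the identity is tested against smooth compactly supported `k`.
  -- Both transforms are moved onto `k`, where Schwartz inversion holds everywhere.
  refine ae_eq_of_integral_contDiff_smul_eq hcont.locallyIntegrable hh.locallyIntegrable ?_
  intro k hk hks
  have hks' : HasCompactSupport fun x => (k x : ℂ) := hks.comp_left Complex.ofReal_zero
  let K : SchwartzMap ℝ ℂ := hks'.toSchwartzMap (Complex.ofRealCLM.contDiff.comp hk)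
  have hK : ∀ x, K x = k x := fun x => rfl
  have hFK : Integrable (𝓕⁻ (K : ℝ → ℂ)) := by
    rw [← SchwartzMap.fourierInv_coe]; exact SchwartzMap.integrable _
  calc ∫ x, k x • 𝓕⁻ (𝓕 h) x = ∫ x, K x * 𝓕⁻ (𝓕 h) x := by simp [hK]
    _ = ∫ x, 𝓕⁻ (K : ℝ → ℂ) x * 𝓕 h x := (integral_fourierInv_mul_eq_flip K.integrable hF).symm
    _ = ∫ x, 𝓕 h x * 𝓕⁻ (K : ℝ → ℂ) x := by simp_rw [mul_comm]
    _ = ∫ x, h x * 𝓕 (𝓕⁻ (K : ℝ → ℂ)) x := by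
      have h := VectorFourier.integral_fourierIntegral_smul_eq_flip (L := innerₗ ℝ)
        Real.continuous_fourierChar continuous_inner hh hFK
      rwa [flip_innerₗ] at h
    _ = ∫ x, k x • h x := by
      have : 𝓕 (𝓕⁻ (K : ℝ → ℂ)) = K := by
        rw [← SchwartzMap.fourierInv_coe, ← SchwartzMap.fourier_coe, FourierTransform.fourier_fourierInv_eq]
      rw [this]
      refine integral_congr_ae (ae_of_all _ fun x => ?_)
      simp [hK, mul_comm]

section

variable {Ω : Type*} [MeasurableSpace Ω] {P : Measure Ω} {Y Z : Ω → ℝ}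
  {g h : ℝ → ℝ}

lemma IsDensityOf.fourier_eq_charFun (hg : IsDensityOf P Y g) (ξ : ℝ) :
    𝓕 (fun x => (g x : ℂ)) ξ = charFun (P.map Y) (-2 * Real.pi * ξ) := by
  rw [charFun_apply_real, hg.integral_map, Real.fourier_real_eq_integral_exp_smul]
  refine integral_congr_ae (ae_of_all _ fun x => ?_)
  simp only [smul_eq_mul, Complex.real_smul]
  rw [mul_comm]
  congr 2
  push_cast
  ring

variable [IsProbabilityMeasure P]

/-- Inversion formula for characteristic functions, almost everywhere. -/
lemma IsDensityOf.ae_eq_integral_charFun (hY : Measurable Y) (hg : IsDensityOf P Y g)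
    (hi : Integrable (charFun (P.map Y))) :
    ∀ᵐ x, (g x : ℂ) = (2 * Real.pi : ℝ)⁻¹ •
      ∫ t : ℝ, Complex.exp (-(t * x) * Complex.I) * charFun (P.map Y) t := by
  have hpi : (-2 * Real.pi) ≠ 0 := by have := Real.pi_pos; nlinarith
  have hF : 𝓕 (fun x => (g x : ℂ)) = fun ξ => charFun (P.map Y) (-2 * Real.pi * ξ) := by
    ext ξ; exact hg.fourier_eq_charFun ξ
  have hFi : Integrable (𝓕 (fun x => (g x : ℂ))) := by
    rw [hF]; exact hi.comp_mul_left' hpi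
  have hgi : Integrable (fun x => (g x : ℂ)) := (hg.integrable hY).ofReal
  filter_upwards [fourierInv_fourier_ae_eq hgi hFi] with x hx
  rw [← hx, hF, Real.fourierInv_eq']
  have := Measure.integral_comp_mul_left
    (fun t : ℝ => Complex.exp (-(t * x) * Complex.I) * charFun (P.map Y) t) (-2 * Real.pi)
  have h2 : |(-2 * Real.pi)⁻¹| = (2 * Real.pi)⁻¹ := by
    rw [show (-2 * Real.pi)⁻¹ = -(2 * Real.pi)⁻¹ by rw [← inv_neg]; ring_nf, abs_neg,
      abs_of_pos (by positivity)]
  rw [h2] at this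
  rw [← this]
  refine integral_congr_ae (ae_of_all _ fun ξ => ?_)
  simp only [smul_eq_mul]
  congr 2
  simp
  ring

/-- The inversion formula holds at every point for a convolution when the first factor
has an integrable characteristic function. -/
lemma IsDensityOf.convolution_eq_integral_charFun (hY : Measurable Y)
    (hg : IsDensityOf P Y g) (hh : IsDensityOf P Z h) (hZ : Measurable Z)
    (hi : Integrable (charFun (P.map Y))) (x : ℝ) :
    ((MeasureTheory.convolution g h (ContinuousLinearMap.lsmul ℝ ℝ) volume x : ℝ) : ℂ) =
      (2 * Real.pi : ℝ)⁻¹ • ∫ t : ℝ, Complex.exp (-(t * x) * Complex.I) *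
        (charFun (P.map Y) t * charFun (P.map Z) t) := by
  have : IsProbabilityMeasure (P.map Z) := Measure.isProbabilityMeasure_map hZ.aemeasurable
  -- Almost everywhere inversion for `g` suffices at every `x`: the convolution averages `g (x - y)`
  -- over the law of `Z`, which is absolutely continuous and ignores the exceptional null set.
  have hinv := hg.ae_eq_integral_charFun hY hi
  have hinv' := (quasiMeasurePreserving_sub_left_of_right_invariant volume x).ae hinv
  have e1 : ((MeasureTheory.convolution g h (ContinuousLinearMap.lsmul ℝ ℝ) volume x : ℝ) : ℂ) =
      ∫ y, (2 * Real.pi : ℝ)⁻¹ • ∫ t : ℝ, Complex.exp (-(t * (x - y : ℝ)) * Complex.I) *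
        charFun (P.map Y) t ∂(volume : Measure ℝ) ∂(P.map Z) := by
    rw [hh.integral_map, convolution_lsmul_swap, ← integral_complex_ofReal]
    refine integral_congr_ae ?_
    filter_upwards [hinv'] with y hy
    rw [← hy]
    simp [mul_comm]
  rw [e1, integral_smul]
  congr 1
  rw [integral_integral_swap]
  · refine integral_congr_ae (ae_of_all _ fun t => ?_)
    simp only
    rw [charFun_apply_real (μ := P.map Z), mul_comm (charFun _ _), ← mul_assoc,
      ← integral_const_mul, ← integral_mul_const]
    refine integral_congr_ae (ae_of_all _ fun y => ?_)
    simp only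
    rw [← Complex.exp_add]
    congr 2
    push_cast; ring
  · have : Integrable (fun p : ℝ × ℝ => charFun (P.map Y) p.2) ((P.map Z).prod volume) := by
      exact hi.comp_snd (P.map Z)
    refine (this.norm).mono' ?_ (ae_of_all _ fun p => ?_)
    · exact (Continuous.aestronglyMeasurable (by fun_prop)).mul this.1
    · simp only [Function.uncurry]
      rw [norm_mul, Complex.norm_exp]
      simp

end

end FourierInversion

/-! ### Integrability of powers of a characteristic function. -/

lemma charFun_mul_conj_eq_integral_prod {κ : Measure ℝ} [IsFiniteMeasure κ] (t : ℝ) :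
    charFun κ t * (starRingEnd ℂ) (charFun κ t) =
      ∫ p : ℝ × ℝ, Complex.exp (t * (p.1 - p.2 : ℝ) * Complex.I) ∂(κ.prod κ) := by
  rw [← charFun_neg, charFun_apply_real, charFun_apply_real, ← integral_prod_mul]
  refine integral_congr_ae (ae_of_all _ fun p => ?_)
  simp only
  rw [← Complex.exp_add]
  congr 1
  push_cast; ring

/-- The squared modulus is the characteristic function of the difference of two independent copies.
The Gaussian weight permits Fubini and contributes its own characteristic function. -/
lemma integral_norm_charFun_sq_gaussianReal {κ : Measure ℝ} [IsFiniteMeasure κ] (v : NNReal) :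
    ∫ t, ‖charFun κ t‖ ^ 2 ∂(gaussianReal 0 v) =
      ∫ p : ℝ × ℝ, Real.exp (-(v * (p.1 - p.2) ^ 2 / 2)) ∂(κ.prod κ) := by
  have h : ((∫ t, ‖charFun κ t‖ ^ 2 ∂(gaussianReal 0 v) : ℝ) : ℂ) =
      ((∫ p : ℝ × ℝ, Real.exp (-(v * (p.1 - p.2) ^ 2 / 2)) ∂(κ.prod κ) : ℝ) : ℂ) := by
    rw [← integral_complex_ofReal, ← integral_complex_ofReal]
    calc ∫ t, ((‖charFun κ t‖ ^ 2 : ℝ) : ℂ) ∂(gaussianReal 0 v)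
        = ∫ t, ∫ p : ℝ × ℝ, Complex.exp (t * (p.1 - p.2 : ℝ) * Complex.I) ∂(κ.prod κ)
          ∂(gaussianReal 0 v) := by
          refine integral_congr_ae (ae_of_all _ fun t => ?_)
          beta_reduce
          rw [← charFun_mul_conj_eq_integral_prod, Complex.mul_conj, Complex.normSq_eq_norm_sq]
      _ = ∫ p : ℝ × ℝ, ∫ t : ℝ, Complex.exp (t * (p.1 - p.2 : ℝ) * Complex.I)
          ∂(gaussianReal 0 v) ∂(κ.prod κ) := by
          refine integral_integral_swap ?_
          refine (integrable_const (1 : ℝ)).mono' (Continuous.aestronglyMeasurable ?_)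
            (ae_of_all _ fun q => ?_)
          · unfold Function.uncurry; fun_prop
          · unfold Function.uncurry
            rw [Complex.norm_exp]
            simp
      _ = _ := by
          refine integral_congr_ae (ae_of_all _ fun p => ?_)
          have := charFun_gaussianReal (μ := 0) (v := v) (p.1 - p.2)
          rw [charFun_apply_real] at this
          beta_reduce
          rw [Complex.ofReal_exp]
          convert this using 2
          · ext t; congr 2; ring
          · push_cast; ring
  exact_mod_cast h

lemma lintegral_exp_neg_mul_sub_sq {v : ℝ} (hv : 0 < v) (x : ℝ) :
    ∫⁻ y, ENNReal.ofReal (Real.exp (-(v * (x - y) ^ 2 / 2))) =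
      ENNReal.ofReal (Real.sqrt (2 * Real.pi / v)) := by
  have h := integrable_exp_neg_mul_sq (b := v / 2) (by positivity)
  rw [← ofReal_integral_eq_lintegral_ofReal]
  · congr 1
    have := integral_sub_left_eq_self (fun y => Real.exp (-(v / 2) * y ^ 2)) volume x
    rw [integral_gaussian] at this
    rw [show 2 * Real.pi / v = Real.pi / (v / 2) by field_simp, ← this]
    congr 1; ext y; congr 1; ring
  · convert h.comp_sub_left x using 2 with y
    congr 1; ring
  · exact ae_of_all _ fun y => (Real.exp_pos _).le

/-- A Plancherel type bound for finite measures with bounded density. -/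
lemma lintegral_norm_charFun_sq_le {κ : Measure ℝ} [IsFiniteMeasure κ] {L : ℝ} (hL : 0 ≤ L)
    (hκ : κ ≤ ENNReal.ofReal L • volume) (hκ1 : κ Set.univ ≤ 1) :
    ∫⁻ t, ‖charFun κ t‖ₑ ^ 2 ≤ ENNReal.ofReal (2 * Real.pi * L) := by
  have hbound : ∀ v : NNReal, 0 < v → ∫⁻ t, ‖charFun κ t‖ₑ ^ 2 ∂(gaussianReal 0 v) ≤
      ENNReal.ofReal (L * Real.sqrt (2 * Real.pi / v)) := by
    intro v hv
    have e1 : ∫⁻ t, ‖charFun κ t‖ₑ ^ 2 ∂(gaussianReal 0 v) =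
        ENNReal.ofReal (∫ t, ‖charFun κ t‖ ^ 2 ∂(gaussianReal 0 v)) := by
      rw [ofReal_integral_eq_lintegral_ofReal]
      · refine lintegral_congr fun t => ?_
        rw [ENNReal.ofReal_pow (norm_nonneg _), ofReal_norm]
      · refine (integrable_const ((κ.real Set.univ) ^ 2)).mono'
          ((measurable_charFun.norm.pow_const 2).aestronglyMeasurable) (ae_of_all _ fun t => ?_)
        rw [Real.norm_of_nonneg (by positivity)]
        gcongr
        exact norm_charFun_le t
      · exact ae_of_all _ fun t => by positivity
    rw [e1, integral_norm_charFun_sq_gaussianReal, ofReal_integral_eq_lintegral_ofReal,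
      lintegral_prod]
    · calc _ ≤ ∫⁻ x, ENNReal.ofReal (L * Real.sqrt (2 * Real.pi / v)) ∂κ := by
            refine lintegral_mono fun x => ?_
            refine (lintegral_mono' hκ le_rfl).trans ?_
            rw [lintegral_smul_measure, lintegral_exp_neg_mul_sub_sq (by exact_mod_cast hv) x,
              ENNReal.ofReal_mul hL, smul_eq_mul]
        _ ≤ _ := by
            rw [lintegral_const]
            exact mul_le_of_le_one_right' hκ1
    · exact Measurable.aemeasurable (by fun_prop)
    · refine (integrable_const (1 : ℝ)).mono' (Continuous.aestronglyMeasurable (by fun_prop))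
        (ae_of_all _ fun p => ?_)
      rw [Real.norm_of_nonneg (Real.exp_pos _).le, Real.exp_le_one_iff]
      have := v.2
      have : 0 ≤ (v : ℝ) * (p.1 - p.2) ^ 2 / 2 := by positivity
      linarith
    · exact ae_of_all _ fun p => (Real.exp_pos _).le
  -- With variance `v = n + 1`, multiplying by `√(2πv)` turns the weight into `exp (-t²/(2v))` and
  -- the bound into `2πL`, free of `v`. Fatou's lemma then removes the weight.
  have hbound' : ∀ n : ℕ, ∫⁻ t, ENNReal.ofReal (Real.exp (-(t ^ 2) / (2 * (n + 1)))) *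
      ‖charFun κ t‖ₑ ^ 2 ≤ ENNReal.ofReal (2 * Real.pi * L) := by
    intro n
    have hv : (0 : NNReal) < n + 1 := by positivity
    have h := hbound (n + 1) hv
    rw [gaussianReal_of_var_ne_zero _ hv.ne', lintegral_withDensity_eq_lintegral_mul _
      (measurable_gaussianPDF _ _) (measurable_charFun.enorm.pow_const 2)] at h
    set s : ℝ := Real.sqrt (2 * Real.pi * (n + 1)) with hs
    have hspos : 0 < s := Real.sqrt_pos.2 (by positivity)
    have h2 := mul_le_mul_right h (ENNReal.ofReal s)
    rw [← lintegral_const_mul _ (by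
      exact (measurable_gaussianPDF _ _).mul (measurable_charFun.enorm.pow_const 2))] at h2
    rw [← ENNReal.ofReal_mul hspos.le] at h2
    convert h2 using 1
    · refine lintegral_congr fun t => ?_
      simp only [Pi.mul_apply, gaussianPDF, gaussianPDFReal]
      rw [← mul_assoc, ← ENNReal.ofReal_mul hspos.le]
      congr 2
      push_cast
      rw [← hs, ← mul_assoc, mul_inv_cancel₀ hspos.ne', one_mul, sub_zero]
    · congr 1
      push_cast
      rw [mul_left_comm, hs, ← Real.sqrt_mul (by positivity)]
      rw [show 2 * Real.pi * ((n : ℝ) + 1) * (2 * Real.pi / (n + 1)) = (2 * Real.pi) ^ 2 by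
        field_simp, Real.sqrt_sq (by positivity)]
      ring
  calc ∫⁻ t, ‖charFun κ t‖ₑ ^ 2
      = ∫⁻ t, liminf (fun n : ℕ => ENNReal.ofReal (Real.exp (-(t ^ 2) / (2 * (n + 1)))) *
        ‖charFun κ t‖ₑ ^ 2) atTop := by
        refine lintegral_congr fun t => (Tendsto.liminf_eq ?_).symm
        have h0 : Tendsto (fun n : ℕ => -(t ^ 2) / (2 * ((n : ℝ) + 1))) atTop (𝓝 0) := by
          refine Tendsto.const_div_atTop ?_ _
          exact (tendsto_natCast_atTop_atTop.atTop_add tendsto_const_nhds).const_mul_atTop two_pos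
        have h1 := ENNReal.tendsto_ofReal ((Real.continuous_exp.tendsto _).comp h0)
        rw [Real.exp_zero, ENNReal.ofReal_one] at h1
        have h2 := ENNReal.Tendsto.mul_const (b := ‖charFun κ t‖ₑ ^ 2) h1 (Or.inr (by finiteness))
        rwa [one_mul] at h2
    _ ≤ liminf (fun n : ℕ => ∫⁻ t, ENNReal.ofReal (Real.exp (-(t ^ 2) / (2 * (n + 1)))) *
        ‖charFun κ t‖ₑ ^ 2) atTop := lintegral_liminf_le fun n => by
          exact (by fun_prop : Measurable _).mul (measurable_charFun.enorm.pow_const 2)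
    _ ≤ liminf (fun _ : ℕ => ENNReal.ofReal (2 * Real.pi * L)) atTop :=
        liminf_le_liminf (Eventually.of_forall hbound')
    _ = _ := liminf_const _

section

variable {Ω : Type*} [MeasurableSpace Ω] {P : Measure Ω} {Y : Ω → ℝ} {f : ℝ → ℝ} {r M : ℝ}

lemma IsDensityOf.lintegral_rpow_le (hf : IsDensityOf P Y f) (hr : 1 < r) (hM : 0 < M)
    (hfM : eLpNorm f (ENNReal.ofReal r) volume ≤ ENNReal.ofReal M) :
    ∫⁻ x, ENNReal.ofReal (f x ^ r) ≤ ENNReal.ofReal (M ^ r) := by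
  have hr0 : 0 < r := by linarith
  rw [eLpNorm_eq_lintegral_rpow_enorm_toReal (by simpa using hr0) ENNReal.ofReal_ne_top,
    ENNReal.toReal_ofReal hr0.le, one_div, ENNReal.rpow_inv_le_iff hr0,
    ENNReal.ofReal_rpow_of_pos hM] at hfM
  refine le_trans (lintegral_mono fun x => ?_) hfM
  rw [Real.enorm_eq_ofReal (hf.2.1 x), ENNReal.ofReal_rpow_of_nonneg (hf.2.1 x) hr0.le]

/-- Mass carried by the region where the density is large. -/
lemma IsDensityOf.map_gt_le (hf : IsDensityOf P Y f) (hr : 1 < r) (hM : 0 < M)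
    (hfM : eLpNorm f (ENNReal.ofReal r) volume ≤ ENNReal.ofReal M) {L : ℝ} (hL : 0 < L) :
    P.map Y {x | L < f x} ≤ ENNReal.ofReal (M ^ r * L ^ (1 - r)) := by
  have hS : MeasurableSet {x | L < f x} := measurableSet_lt measurable_const hf.1
  rw [hf.2.2, withDensity_apply _ hS]
  calc ∫⁻ x in {x | L < f x}, ENNReal.ofReal (f x)
      ≤ ∫⁻ x in {x | L < f x}, ENNReal.ofReal (f x ^ r) * ENNReal.ofReal (L ^ (1 - r)) := by
        refine setLIntegral_mono_ae (by have := hf.1; fun_prop) (ae_of_all _ fun x hx => ?_)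
        rw [← ENNReal.ofReal_mul (Real.rpow_nonneg (hf.2.1 x) _)]
        refine ENNReal.ofReal_le_ofReal ?_
        have hx0 : 0 < f x := hL.trans hx
        calc f x = f x ^ r * f x ^ (1 - r) := by
              rw [← Real.rpow_add hx0]; simp
          _ ≤ f x ^ r * L ^ (1 - r) := by
              refine mul_le_mul_of_nonneg_left ?_ (Real.rpow_nonneg hx0.le _)
              exact Real.rpow_le_rpow_of_nonpos hL (le_of_lt hx) (sub_nonpos.2 hr.le)
    _ ≤ ∫⁻ x, ENNReal.ofReal (f x ^ r) * ENNReal.ofReal (L ^ (1 - r)) := setLIntegral_le_lintegral _ _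
    _ ≤ _ := by
        rw [lintegral_mul_const _ (by have := hf.1; fun_prop), ENNReal.ofReal_mul (by positivity)]
        gcongr
        exact hf.lintegral_rpow_le hr hM hfM

variable [IsProbabilityMeasure P]

/-- Weak type bound for the characteristic function of a law with density in `L^r`. -/
lemma IsDensityOf.volume_lt_norm_charFun_le (hY : Measurable Y) (hf : IsDensityOf P Y f)
    (hr : 1 < r) (hM : 0 < M) (hfM : eLpNorm f (ENNReal.ofReal r) volume ≤ ENNReal.ofReal M)
    {s : ℝ} (hs : 0 < s) :
    volume {t | s < ‖charFun (P.map Y) t‖} ≤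
      ENNReal.ofReal (8 * Real.pi * (2 * M ^ r / s) ^ (1 / (r - 1)) / s ^ 2) := by
  have : IsProbabilityMeasure (P.map Y) := Measure.isProbabilityMeasure_map hY.aemeasurable
  set ν := P.map Y with hν
  -- At this level the mass where `f > L` is at most `s / 2`. So `|φ| > s` forces the characteristic
  -- function of the part with density at most `L` to exceed `s / 2`, and Plancherel with Markov's
  -- inequality bounds the measure of such `t`.
  set L := (2 * M ^ r / s) ^ (1 / (r - 1)) with hLdef
  have hMr : 0 < M ^ r := Real.rpow_pos_of_pos hM r
  have hr1 : 0 < r - 1 := by linarith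
  have hL : 0 < L := by positivity
  have hLr : M ^ r * L ^ (1 - r) = s / 2 := by
    rw [hLdef, ← Real.rpow_mul (by positivity), show 1 / (r - 1) * (1 - r) = -1 by
      field_simp; ring, Real.rpow_neg_one]
    field_simp
  have hT : MeasurableSet {x | L < f x} := measurableSet_lt measurable_const hf.1
  set S : Set ℝ := {x | L < f x}ᶜ with hSdef
  have hS : MeasurableSet S := hT.compl
  have hle : ν.restrict S ≤ ENNReal.ofReal L • volume := by
    refine Measure.le_iff.2 fun A hA => ?_
    rw [Measure.restrict_apply hA, hν, hf.2.2, withDensity_apply _ (hA.inter hS)]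
    calc ∫⁻ x in A ∩ S, ENNReal.ofReal (f x) ≤ ∫⁻ x in A ∩ S, ENNReal.ofReal L := by
          refine setLIntegral_mono measurable_const fun x hx => ?_
          exact ENNReal.ofReal_le_ofReal (not_lt.1 hx.2)
      _ ≤ _ := by
          rw [setLIntegral_const, Measure.smul_apply, smul_eq_mul]
          gcongr
          exact Set.inter_subset_left
  have hpl := lintegral_norm_charFun_sq_le hL.le hle (by simpa using prob_le_one)
  have hsplit : ∀ t, charFun ν t = charFun (ν.restrict S) t + charFun (ν.restrict Sᶜ) t := by
    intro t
    simp only [charFun_apply_real]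
    refine (integral_add_compl hS ?_).symm
    refine (integrable_const (1 : ℝ)).mono' (Continuous.aestronglyMeasurable (by fun_prop))
      (ae_of_all _ fun x => ?_)
    rw [Complex.norm_exp]; simp
  have hsmall : ∀ t, ‖charFun (ν.restrict Sᶜ) t‖ ≤ s / 2 := by
    intro t
    refine (norm_charFun_le t).trans ?_
    rw [measureReal_restrict_apply_univ, measureReal_def, hSdef, compl_compl]
    refine ENNReal.toReal_le_of_le_ofReal (by positivity) ?_
    rw [← hLr]
    exact hf.map_gt_le hr hM hfM hL
  have hsub : {t | s < ‖charFun ν t‖} ⊆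
      {t | ENNReal.ofReal ((s / 2) ^ 2) ≤ ‖charFun (ν.restrict S) t‖ₑ ^ 2} := by
    intro t ht
    simp only [Set.mem_ofPred_eq] at ht ⊢
    rw [hsplit t] at ht
    have h1 := norm_add_le (charFun (ν.restrict S) t) (charFun (ν.restrict Sᶜ) t)
    have h2 := hsmall t
    rw [← ofReal_norm, ← ENNReal.ofReal_pow (norm_nonneg _)]
    refine ENNReal.ofReal_le_ofReal ?_
    gcongr
    linarith
  refine (measure_mono hsub).trans ?_
  refine (meas_ge_le_lintegral_div (measurable_charFun.enorm.pow_const 2).aemeasurable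
    (by simpa using hs.ne') ENNReal.ofReal_ne_top).trans ?_
  refine (ENNReal.div_le_div_right hpl _).trans ?_
  rw [← ENNReal.ofReal_div_of_pos (by positivity)]
  refine ENNReal.ofReal_le_ofReal (le_of_eq ?_)
  field_simp
  ring

/-- The characteristic function of a law with density in `L^r` is in `L^p` for `p ≥ 2 r'`. -/
lemma IsDensityOf.lintegral_norm_charFun_pow_le (hY : Measurable Y) (hf : IsDensityOf P Y f)
    (hr : 1 < r) (hr2 : r ≤ 2) (hM : 0 < M)
    (hfM : eLpNorm f (ENNReal.ofReal r) volume ≤ ENNReal.ofReal M)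
    {p : ℕ} (hp : 2 * (r / (r - 1)) ≤ p) :
    ∫⁻ t, ‖charFun (P.map Y) t‖ₑ ^ p ≤
      ENNReal.ofReal (p * (8 * Real.pi * (2 * M ^ r) ^ (1 / (r - 1)))) := by
  have : IsProbabilityMeasure (P.map Y) := Measure.isProbabilityMeasure_map hY.aemeasurable
  set ν := P.map Y with hν
  set C := 8 * Real.pi * (2 * M ^ r) ^ (1 / (r - 1)) with hC
  have hr1 : 0 < r - 1 := by linarith
  have hMr : 0 < M ^ r := Real.rpow_pos_of_pos hM r
  have hq : 1 ≤ 1 / (r - 1) := by rw [le_div_iff₀ hr1]; linarith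
  have hrr : r / (r - 1) = 1 + 1 / (r - 1) := by field_simp; ring
  -- In the layer cake formula the weak type bound leaves `s` to this power, integrable on `(0, 1]`.
  -- Nonnegativity follows from `p ≥ 2 + 2/(r-1)` and `1/(r-1) ≥ 1`, the latter being `r ≤ 2`.
  have hp' : 0 ≤ (p : ℝ) - 3 - 1 / (r - 1) := by rw [hrr] at hp; linarith
  have hp0 : (0 : ℝ) < p := by linarith
  have h := lintegral_rpow_eq_lintegral_meas_lt_mul volume (f := fun t => ‖charFun ν t‖)
    (ae_of_all _ fun t => norm_nonneg _) measurable_charFun.norm.aemeasurable hp0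
  have e1 : ∫⁻ t, ‖charFun ν t‖ₑ ^ p = ∫⁻ t, ENNReal.ofReal (‖charFun ν t‖ ^ (p : ℝ)) := by
    refine lintegral_congr fun t => ?_
    rw [Real.rpow_natCast, ENNReal.ofReal_pow (norm_nonneg _), ofReal_norm]
  rw [e1, h, ENNReal.ofReal_mul hp0.le]
  gcongr
  calc ∫⁻ s in Set.Ioi (0 : ℝ), volume {t | s < ‖charFun ν t‖} * ENNReal.ofReal (s ^ ((p : ℝ) - 1))
      ≤ ∫⁻ s in Set.Ioi (0 : ℝ), (Set.Ioc (0 : ℝ) 1).indicator (fun _ => ENNReal.ofReal C) s := by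
        refine setLIntegral_mono (measurable_const.indicator measurableSet_Ioc) fun s hs => ?_
        have hs0 : 0 < s := hs
        by_cases hs1 : s ≤ 1
        · rw [Set.indicator_of_mem (show s ∈ Set.Ioc (0 : ℝ) 1 from ⟨hs0, hs1⟩)]
          refine (mul_le_mul_left (hf.volume_lt_norm_charFun_le hY hr hM hfM hs0) _).trans ?_
          rw [← ENNReal.ofReal_mul (by positivity)]
          refine ENNReal.ofReal_le_ofReal ?_
          have : 8 * Real.pi * (2 * M ^ r / s) ^ (1 / (r - 1)) / s ^ 2 * s ^ ((p : ℝ) - 1) =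
              C * s ^ ((p : ℝ) - 3 - 1 / (r - 1)) := by
            rw [Real.div_rpow (by positivity) hs0.le,
              show (p : ℝ) - 1 = ((p : ℝ) - 3 - 1 / (r - 1)) + 1 / (r - 1) + (2 : ℕ) by
                push_cast; ring, Real.rpow_add hs0, Real.rpow_add hs0, Real.rpow_natCast, hC]
            have : 0 < s ^ (1 / (r - 1)) := by positivity
            field_simp
          rw [this]
          exact mul_le_of_le_one_right (by positivity) (Real.rpow_le_one hs0.le hs1 hp')
        · have : {t | s < ‖charFun ν t‖} = ∅ := by
            ext t
            simpa using (norm_charFun_le_one t).trans (not_le.1 hs1).le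
          rw [this]; simp
    _ ≤ ∫⁻ s, (Set.Ioc (0 : ℝ) 1).indicator (fun _ => ENNReal.ofReal C) s :=
        setLIntegral_le_lintegral _ _
    _ = ENNReal.ofReal C := by simp

end

/-- Hölder's inequality for a product of `N` functions in `L^N`. -/
lemma lintegral_prod_le_of_forall_lintegral_pow_le {ι α : Type*} [MeasurableSpace α]
    {μ : Measure α} (s : Finset ι) (hs : s.Nonempty) {F : ι → α → ENNReal}
    (hF : ∀ i ∈ s, AEMeasurable (F i) μ) {C : ENNReal}
    (hC : ∀ i ∈ s, ∫⁻ a, F i a ^ s.card ∂μ ≤ C) :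
    ∫⁻ a, ∏ i ∈ s, F i a ∂μ ≤ C := by
  have hN : (s.card : ℝ) ≠ 0 := by exact_mod_cast hs.card_pos.ne'
  have hsum : ∑ i ∈ s, (1 / (s.card : ℝ)) = 1 := by
    rw [Finset.sum_const, nsmul_eq_mul]; field_simp
  have h := ENNReal.lintegral_prod_norm_pow_le (μ := μ) s (f := fun i a => F i a ^ s.card)
    (fun i hi => (hF i hi).pow_const _) hsum (fun i _ => by positivity)
  have hpow : ∀ z : ENNReal, (z ^ s.card) ^ (1 / (s.card : ℝ)) = z := by
    intro z
    rw [← ENNReal.rpow_natCast, ← ENNReal.rpow_mul, mul_one_div_cancel hN, ENNReal.rpow_one]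
  simp only [hpow] at h
  refine h.trans ?_
  calc _ ≤ ∏ i ∈ s, C ^ (1 / (s.card : ℝ)) := by
        refine Finset.prod_le_prod' fun i hi => ?_
        exact ENNReal.rpow_le_rpow (hC i hi) (by positivity)
    _ = C := by
        rw [Finset.prod_const, ← ENNReal.rpow_natCast, ← ENNReal.rpow_mul, one_div_mul_cancel hN,
          ENNReal.rpow_one]

/-! ### Anti-concentration and a quantitative Cramér condition. -/

/-- Sets of Lebesgue measure at most `uniformScale r M` have probability at most `1 / 4` under
every law with a density of `L^r` norm at most `M`. -/
noncomputable def uniformScale (r M : ℝ) : ℝ := 1 / (8 * (8 * M ^ r) ^ (1 / (r - 1)))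

lemma uniformScale_pos {r M : ℝ} (hM : 0 < M) : 0 < uniformScale r M := by
  unfold uniformScale; positivity

/-- Chebyshev's inequality at twice the standard deviation. -/
lemma measureReal_two_mul_sqrt_lt_abs_le {ν : Measure ℝ} [IsProbabilityMeasure ν] {V : ℝ}
    (hV : 0 < V) (hsq : Integrable (fun x => x ^ 2) ν) (hle : ∫ x, x ^ 2 ∂ν ≤ V) :
    ν.real {x | 2 * Real.sqrt V < |x|} ≤ 1 / 4 := by
  have h := mul_meas_ge_le_integral_of_nonneg (μ := ν) (f := fun x : ℝ => x ^ 2)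
    (ae_of_all _ fun x => sq_nonneg x) hsq (4 * V)
  have hsub : {x : ℝ | 2 * Real.sqrt V < |x|} ⊆ {x | 4 * V ≤ x ^ 2} := by
    intro x hx
    simp only [Set.mem_ofPred_eq] at hx ⊢
    have h1 : (2 * Real.sqrt V) ^ 2 ≤ |x| ^ 2 := by gcongr
    rw [mul_pow, Real.sq_sqrt hV.le, sq_abs] at h1
    linarith
  have h2 := measureReal_mono hsub (μ := ν)
  have h3 : 4 * V * ν.real {x | 4 * V ≤ x ^ 2} ≤ V := h.trans hle
  have h4 : ν.real {x : ℝ | 4 * V ≤ x ^ 2} ≤ 1 / 4 := by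
    by_contra hcon
    push Not at hcon
    nlinarith
  exact h2.trans h4

/-- The points of `[-R, R]` where `cos (u x - θ)` is close to `1` form a set of small measure. -/
lemma volume_cos_near_one_le {u θ R ρ : ℝ} (hu : u ≠ 0) (hR : 2 ≤ R * |u|) (hρ : 0 ≤ ρ) :
    volume {x : ℝ | |x| ≤ R ∧ 1 - Real.cos (u * x - θ) < 2 * ρ ^ 2 / Real.pi ^ 2} ≤
      ENNReal.ofReal (4 * R * ρ) := by
  have hpi := Real.pi_pos
  have hu' : 0 < |u| := abs_pos.2 hu
  set α : ℝ := -θ / (2 * Real.pi) - R * |u| / (2 * Real.pi) - 1 / 2 with hα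
  set β : ℝ := -θ / (2 * Real.pi) + R * |u| / (2 * Real.pi) + 1 / 2 with hβ
  -- Since `cos y ≤ 1 - 2y²/π²` on `[-π, π]`, such `x` lie within `ρ/|u|` of a point `(θ + 2πk)/u`.
  -- At most `R|u|/π + 2 ≤ 2R|u|` values of `k` are relevant, so `u` cancels from the total length.
  have hsub : {x : ℝ | |x| ≤ R ∧ 1 - Real.cos (u * x - θ) < 2 * ρ ^ 2 / Real.pi ^ 2} ⊆
      ⋃ k ∈ Finset.Icc ⌈α⌉ ⌊β⌋,
        Metric.closedBall ((θ + 2 * Real.pi * (k : ℤ)) / u) (ρ / |u|) := by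
    rintro x ⟨hx, hcos⟩
    set z := (u * x - θ) / (2 * Real.pi) with hz
    have hzeq : u * x - θ = 2 * Real.pi * z := by rw [hz]; field_simp
    have hround := abs_sub_round z
    have hux : |u * x| ≤ R * |u| := by rw [abs_mul, mul_comm]; gcongr
    have hz2 : |z - -θ / (2 * Real.pi)| ≤ R * |u| / (2 * Real.pi) := by
      have : z - -θ / (2 * Real.pi) = u * x / (2 * Real.pi) := by rw [hz]; ring
      rw [this, abs_div, abs_of_pos (by positivity : 0 < 2 * Real.pi)]
      gcongr
    rw [abs_le] at hround hz2
    simp only [Set.mem_iUnion, Finset.mem_Icc]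
    refine ⟨round z, ⟨Int.ceil_le.2 (by linarith), Int.le_floor.2 (by linarith)⟩, ?_⟩
    set y := u * x - θ - 2 * Real.pi * (round z : ℤ) with hy
    have hyz : y = 2 * Real.pi * (z - round z) := by rw [hy, hzeq]; ring
    have hycos : Real.cos (u * x - θ) = Real.cos y := by
      rw [hy, show 2 * Real.pi * ((round z : ℤ) : ℝ) = (round z : ℤ) * (2 * Real.pi) by ring,
        Real.cos_sub_int_mul_two_pi]
    have hypi : |y| ≤ Real.pi := by
      rw [hyz, abs_le]; constructor <;> nlinarith
    have hquad := Real.cos_le_one_sub_mul_cos_sq hypi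
    rw [hycos] at hcos
    have h1 : 2 / Real.pi ^ 2 * y ^ 2 < 2 * ρ ^ 2 / Real.pi ^ 2 := by linarith
    have h2 : y ^ 2 < ρ ^ 2 := by
      have h3 : 2 / Real.pi ^ 2 * y ^ 2 < 2 / Real.pi ^ 2 * ρ ^ 2 := by
        rwa [show 2 / Real.pi ^ 2 * ρ ^ 2 = 2 * ρ ^ 2 / Real.pi ^ 2 by ring]
      exact lt_of_mul_lt_mul_left h3 (by positivity)
    have h3 : |y| ≤ ρ := abs_le_of_sq_le_sq h2.le hρ
    rw [Metric.mem_closedBall, Real.dist_eq]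
    have : x - (θ + 2 * Real.pi * (round z : ℤ)) / u = y / u := by
      rw [hy]; field_simp; ring
    rw [this, abs_div]
    gcongr
  have hRpos : 0 < R := by
    by_contra hcon
    push Not at hcon
    nlinarith
  refine (measure_mono hsub).trans ((measure_biUnion_finset_le _ _).trans ?_)
  simp only [Real.volume_closedBall, Finset.sum_const, nsmul_eq_mul, Int.card_Icc]
  rw [← ENNReal.ofReal_natCast, ← ENNReal.ofReal_mul (Nat.cast_nonneg _)]
  refine ENNReal.ofReal_le_ofReal ?_
  have hβα : β - α = R * |u| / Real.pi + 1 := by rw [hα, hβ]; field_simp; ring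
  have hcard : (((⌊β⌋ + 1 - ⌈α⌉).toNat : ℕ) : ℝ) ≤ R * |u| / Real.pi + 2 := by
    have h1 : (((⌊β⌋ + 1 - ⌈α⌉).toNat : ℕ) : ℝ) = ((max (⌊β⌋ + 1 - ⌈α⌉) 0 : ℤ) : ℝ) := by
      rw [← Int.toNat_eq_max]; rfl
    rw [h1, Int.cast_max]
    refine max_le ?_ (by push_cast; positivity)
    have := Int.floor_le β
    have := Int.le_ceil α
    push_cast
    linarith
  have hpi1 : R * |u| / Real.pi ≤ R * |u| :=
    div_le_self (by positivity) (by linarith [Real.pi_gt_three])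
  calc (((⌊β⌋ + 1 - ⌈α⌉).toNat : ℕ) : ℝ) * (2 * (ρ / |u|))
      ≤ (2 * (R * |u|)) * (2 * (ρ / |u|)) := by gcongr; linarith
    _ = 4 * R * ρ := by field_simp; ring

/-- Rotating by its argument makes the characteristic function real and nonnegative, so only the
real part of the integrand remains. -/
lemma norm_charFun_eq_integral_cos {ν : Measure ℝ} [IsFiniteMeasure ν] (u : ℝ) :
    ∃ θ : ℝ, ‖charFun ν u‖ = ∫ x, Real.cos (u * x - θ) ∂ν := by
  refine ⟨(charFun ν u).arg, ?_⟩
  set θ := (charFun ν u).arg with hθ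
  have h1 : ((‖charFun ν u‖ : ℝ) : ℂ) = charFun ν u * Complex.exp (-θ * Complex.I) := by
    conv_rhs => rw [← Complex.norm_mul_exp_arg_mul_I (charFun ν u), ← hθ, mul_assoc,
      ← Complex.exp_add]
    simp
  have h2 : ((‖charFun ν u‖ : ℝ) : ℂ) = ∫ x, Complex.exp ((u * x - θ : ℝ) * Complex.I) ∂ν := by
    rw [h1, charFun_apply_real, ← integral_mul_const]
    refine integral_congr_ae (ae_of_all _ fun x => ?_)
    beta_reduce
    rw [← Complex.exp_add]
    congr 1
    push_cast; ring
  have hint : Integrable (fun x => Complex.exp ((u * x - θ : ℝ) * Complex.I)) ν := by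
    refine (integrable_const (1 : ℝ)).mono' (Continuous.aestronglyMeasurable (by fun_prop))
      (ae_of_all _ fun x => ?_)
    rw [Complex.norm_exp_ofReal_mul_I]
  have h3 := congrArg Complex.re h2
  rw [Complex.ofReal_re] at h3
  rw [h3, ← RCLike.re_eq_complex_re, ← integral_re hint]
  refine integral_congr_ae (ae_of_all _ fun x => ?_)
  simp only [RCLike.re_eq_complex_re]
  exact Complex.exp_ofReal_mul_I_re _

section

variable {Ω : Type*} [MeasurableSpace Ω] {P : Measure Ω} {Y : Ω → ℝ}
  {f : ℝ → ℝ} {r M : ℝ}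

lemma IsDensityOf.measureReal_le_of_volume_le (hf : IsDensityOf P Y f)
    (hr : 1 < r) (hM : 0 < M) (hfM : eLpNorm f (ENNReal.ofReal r) volume ≤ ENNReal.ofReal M)
    {A : Set ℝ} (hA : volume A ≤ ENNReal.ofReal (uniformScale r M)) :
    (P.map Y).real A ≤ 1 / 4 := by
  -- At this level `M ^ r * L ^ (1 - r) = 1/8`, and `uniformScale` is `1/(8L)`: the parts of `A`
  -- above and below the level each have mass at most `1/8`.
  set L := (8 * M ^ r) ^ (1 / (r - 1)) with hLdef
  have hMr : 0 < M ^ r := Real.rpow_pos_of_pos hM r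
  have hr1 : 0 < r - 1 := by linarith
  have hL : 0 < L := by positivity
  have hLr : M ^ r * L ^ (1 - r) = 1 / 8 := by
    rw [hLdef, ← Real.rpow_mul (by positivity), show 1 / (r - 1) * (1 - r) = -1 by
      field_simp; ring, Real.rpow_neg_one]
    field_simp
  -- `A` need not be measurable, hence the measurable hull.
  have hsub : A ⊆ {x | L < f x} ∪ (toMeasurable volume A ∩ {x | L < f x}ᶜ) := by
    intro x hx
    by_cases h : L < f x
    · exact Or.inl h
    · exact Or.inr ⟨subset_toMeasurable _ _ hx, h⟩
  have h1 := hf.map_gt_le hr hM hfM hL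
  rw [hLr] at h1
  have hT : MeasurableSet {x | L < f x} := measurableSet_lt measurable_const hf.1
  have h2 : P.map Y (toMeasurable volume A ∩ {x | L < f x}ᶜ) ≤ ENNReal.ofReal (1 / 8) := by
    have hm := (measurableSet_toMeasurable volume A).inter hT.compl
    rw [hf.2.2, withDensity_apply _ hm]
    calc _ ≤ ∫⁻ x in toMeasurable volume A ∩ {x | L < f x}ᶜ, ENNReal.ofReal L := by
          refine setLIntegral_mono measurable_const fun x hx => ?_
          exact ENNReal.ofReal_le_ofReal (not_lt.1 hx.2)
      _ ≤ ENNReal.ofReal L * ENNReal.ofReal (uniformScale r M) := by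
          rw [setLIntegral_const]
          gcongr
          refine (measure_mono Set.inter_subset_left).trans ?_
          rwa [measure_toMeasurable]
      _ = _ := by
          rw [← ENNReal.ofReal_mul hL.le, uniformScale, ← hLdef]
          congr 1
          field_simp
  refine ENNReal.toReal_le_of_le_ofReal (by norm_num) ?_
  refine (measure_mono hsub).trans ((measure_union_le _ _).trans ?_)
  refine (add_le_add h1 h2).trans ?_
  rw [← ENNReal.ofReal_add (by norm_num) (by norm_num)]
  norm_num

variable [IsProbabilityMeasure P]

/-- A law with density bounded in `L^r` has second moment bounded below. -/
lemma IsDensityOf.lt_of_second_moment_le (hY : Measurable Y) (hf : IsDensityOf P Y f)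
    (hr : 1 < r) (hM : 0 < M) (hfM : eLpNorm f (ENNReal.ofReal r) volume ≤ ENNReal.ofReal M)
    {V : ℝ} (hV : 0 < V) (hsq : Integrable (fun x => x ^ 2) (P.map Y))
    (hle : ∫ x, x ^ 2 ∂(P.map Y) ≤ V) : uniformScale r M ^ 2 / 16 < V := by
  have : IsProbabilityMeasure (P.map Y) := Measure.isProbabilityMeasure_map hY.aemeasurable
  by_contra hcon
  push Not at hcon
  have ha := uniformScale_pos (r := r) hM
  -- The interval `[-2√V, 2√V]` would then be short enough to have mass at most `1/4`. Chebyshev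
  -- leaves at most `1/4` outside, contradicting total mass one.
  have hs : 4 * Real.sqrt V ≤ uniformScale r M := by
    rw [← le_div_iff₀' (by norm_num), Real.sqrt_le_left (by positivity)]
    rw [div_pow]; norm_num; linarith
  have h1 := measureReal_two_mul_sqrt_lt_abs_le hV hsq hle
  have h2 : (P.map Y).real (Metric.closedBall 0 (2 * Real.sqrt V)) ≤ 1 / 4 := by
    refine hf.measureReal_le_of_volume_le hr hM hfM ?_
    rw [Real.volume_closedBall]
    exact ENNReal.ofReal_le_ofReal (by linarith)
  have h3 : (P.map Y).real Set.univ ≤ 1 / 4 + 1 / 4 := by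
    refine (measureReal_mono (fun x _ => ?_)).trans ((measureReal_union_le _ _).trans
      (add_le_add h1 h2))
    by_cases hx : 2 * Real.sqrt V < |x|
    · exact Or.inl hx
    · right; simpa using not_lt.1 hx
  rw [probReal_univ] at h3
  norm_num at h3

/-- This is what makes the row variances grow at least linearly in `n`. -/
lemma IsDensityOf.le_second_moment (hY : Measurable Y) (hf : IsDensityOf P Y f)
    (hr : 1 < r) (hM : 0 < M) (hfM : eLpNorm f (ENNReal.ofReal r) volume ≤ ENNReal.ofReal M)
    (hsq : Integrable (fun x => x ^ 2) (P.map Y)) :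
    uniformScale r M ^ 2 / 16 ≤ ∫ x, x ^ 2 ∂(P.map Y) := by
  have ha := uniformScale_pos (r := r) hM
  by_contra hcon
  push Not at hcon
  exact lt_irrefl _ (hf.lt_of_second_moment_le hY hr hM hfM (by positivity) hsq hcon.le)

/-- A quantitative Cramér condition for laws with density bounded in `L^r`. -/
lemma IsDensityOf.norm_charFun_le_one_sub (hY : Measurable Y) (hf : IsDensityOf P Y f)
    (hr : 1 < r) (hM : 0 < M) (hfM : eLpNorm f (ENNReal.ofReal r) volume ≤ ENNReal.ofReal M)
    {V : ℝ} (hV : 0 < V) (hsq : Integrable (fun x => x ^ 2) (P.map Y))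
    (hle : ∫ x, x ^ 2 ∂(P.map Y) ≤ V) {u : ℝ} (hu : 1 ≤ |u| * Real.sqrt V) :
    ‖charFun (P.map Y) u‖ ≤ 1 - uniformScale r M ^ 2 / (64 * Real.pi ^ 2) / V := by
  have : IsProbabilityMeasure (P.map Y) := Measure.isProbabilityMeasure_map hY.aemeasurable
  have ha := uniformScale_pos (r := r) hM
  set a := uniformScale r M with hadef
  set ν := P.map Y with hν
  have hsV : 0 < Real.sqrt V := Real.sqrt_pos.2 hV
  have hu0 : u ≠ 0 := by rintro rfl; simp at hu; linarith
  obtain ⟨θ, hθ⟩ := norm_charFun_eq_integral_cos (ν := ν) u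
  -- With `R = 2√V` the length bound `4Rρ` is exactly `uniformScale`. Hence `1 - cos ≥ η` with
  -- probability at least `1/2`, and `1 - |φ| ≥ η/2`.
  set ρ := a / (8 * Real.sqrt V) with hρ
  set η := 2 * ρ ^ 2 / Real.pi ^ 2 with hη
  have hηV : η / 2 = a ^ 2 / (64 * Real.pi ^ 2) / V := by
    rw [hη, hρ, div_pow, mul_pow, Real.sq_sqrt hV.le]; field_simp; norm_num
  have hE : ν.real {x : ℝ | |x| ≤ 2 * Real.sqrt V ∧ 1 - Real.cos (u * x - θ) < η} ≤ 1 / 4 := by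
    refine hf.measureReal_le_of_volume_le hr hM hfM ?_
    refine (volume_cos_near_one_le hu0 (by linarith) (by positivity)).trans ?_
    refine ENNReal.ofReal_le_ofReal (le_of_eq ?_)
    rw [hρ, ← hadef]; field_simp; norm_num
  have hcosint : Integrable (fun x => Real.cos (u * x - θ)) ν := by
    refine (integrable_const (1 : ℝ)).mono' (Continuous.aestronglyMeasurable (by fun_prop))
      (ae_of_all _ fun x => Real.abs_cos_le_one _)
  have hint : Integrable (fun x => 1 - Real.cos (u * x - θ)) ν :=
    (integrable_const 1).sub hcosint
  have hmk := mul_meas_ge_le_integral_of_nonneg (μ := ν)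
    (ae_of_all _ fun x => sub_nonneg.2 (Real.cos_le_one (u * x - θ))) hint η
  rw [integral_sub (integrable_const 1) hcosint, ← hθ, integral_const, probReal_univ,
    smul_eq_mul, mul_one] at hmk
  have hch := measureReal_two_mul_sqrt_lt_abs_le hV hsq hle
  have hcover : (1 : ℝ) ≤ ν.real {x | η ≤ 1 - Real.cos (u * x - θ)} + (1 / 4 + 1 / 4) := by
    refine (probReal_univ (μ := ν)).ge.trans ?_
    refine (measureReal_mono (s₂ := {x | η ≤ 1 - Real.cos (u * x - θ)} ∪
      ({x | 2 * Real.sqrt V < |x|} ∪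
      {x : ℝ | |x| ≤ 2 * Real.sqrt V ∧ 1 - Real.cos (u * x - θ) < η})) fun x _ => ?_).trans
      ((measureReal_union_le _ _).trans (add_le_add le_rfl
      ((measureReal_union_le _ _).trans (add_le_add hch hE))))
    by_cases h1 : η ≤ 1 - Real.cos (u * x - θ)
    · exact Or.inl h1
    · by_cases h2 : 2 * Real.sqrt V < |x|
      · exact Or.inr (Or.inl h2)
      · exact Or.inr (Or.inr ⟨not_lt.1 h2, not_le.1 h1⟩)
  have hη0 : 0 ≤ η := by positivity
  rw [← hηV]
  nlinarith

end

/-! ### Characteristic functions near the origin. -/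

/-- The derivative of each Taylor remainder of `exp (iy)` is, up to the factor `i`, the preceding
remainder, so the bounds follow by successive integration. Negative `y` is handled by conjugation.
-/
lemma norm_exp_mul_I_sub_one_sub_le (y : ℝ) :
    ‖Complex.exp (y * Complex.I) - 1 - y * Complex.I‖ ≤ y ^ 2 / 2 := by
  have key : ∀ y : ℝ, 0 ≤ y →
      ‖Complex.exp (y * Complex.I) - 1 - y * Complex.I‖ ≤ y ^ 2 / 2 := by
    intro y hy
    have hd : ∀ x : ℝ, HasDerivAt
        (fun x : ℝ => Complex.exp (x * Complex.I) - 1 - x * Complex.I)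
        (Complex.I * (Complex.exp (x * Complex.I) - 1)) x := by
      intro x
      have h1 : HasDerivAt (fun x : ℝ => (x : ℂ) * Complex.I) Complex.I x := by
        simpa using (Complex.ofRealCLM.hasDerivAt (x := x)).mul_const Complex.I
      refine (((h1.cexp).sub_const 1).fun_sub h1).congr_deriv ?_
      ring
    have hB : ∀ x : ℝ, HasDerivAt (fun x : ℝ => x ^ 2 / 2) x x := by
      intro x
      refine ((hasDerivAt_pow 2 x).div_const 2).congr_deriv ?_
      simp
    refine image_norm_le_of_norm_deriv_right_le_deriv_boundary (a := 0) (b := y)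
      (f := fun x : ℝ => Complex.exp (x * Complex.I) - 1 - x * Complex.I)
      (fun x _ => (hd x).continuousAt.continuousWithinAt)
      (fun x _ => (hd x).hasDerivWithinAt) (by simp) hB (fun x hx => ?_) ⟨hy, le_rfl⟩
    rw [norm_mul, Complex.norm_I, one_mul, mul_comm]
    refine Real.norm_exp_I_mul_ofReal_sub_one_le.trans ?_
    rw [Real.norm_of_nonneg hx.1]
  rcases le_total 0 y with hy | hy
  · exact key y hy
  · have h := key (-y) (by linarith)
    rw [← Complex.norm_conj] at h
    simpa [← Complex.exp_conj, sub_eq_add_neg] using h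

lemma norm_exp_mul_I_sub_taylor_two_le (y : ℝ) :
    ‖Complex.exp (y * Complex.I) - 1 - y * Complex.I + y ^ 2 / 2‖ ≤ |y| ^ 3 / 6 := by
  have key : ∀ y : ℝ, 0 ≤ y →
      ‖Complex.exp (y * Complex.I) - 1 - y * Complex.I + y ^ 2 / 2‖ ≤ y ^ 3 / 6 := by
    intro y hy
    have hd : ∀ x : ℝ, HasDerivAt
        (fun x : ℝ => Complex.exp (x * Complex.I) - 1 - x * Complex.I + (x : ℂ) ^ 2 / 2)
        (Complex.I * (Complex.exp (x * Complex.I) - 1 - x * Complex.I)) x := by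
      intro x
      have h0 : HasDerivAt (fun x : ℝ => (x : ℂ)) 1 x := Complex.ofRealCLM.hasDerivAt (x := x)
      have h1 : HasDerivAt (fun x : ℝ => (x : ℂ) * Complex.I) Complex.I x := by
        simpa using h0.mul_const Complex.I
      refine ((((h1.cexp).sub_const 1).fun_sub h1).fun_add
        ((h0.fun_pow 2).div_const 2)).congr_deriv ?_
      push_cast
      linear_combination (x : ℂ) * Complex.I_sq
    have hB : ∀ x : ℝ, HasDerivAt (fun x : ℝ => x ^ 3 / 6) (x ^ 2 / 2) x := by
      intro x
      refine ((hasDerivAt_pow 3 x).div_const 6).congr_deriv ?_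
      norm_num; ring
    refine image_norm_le_of_norm_deriv_right_le_deriv_boundary (a := 0) (b := y)
      (f := fun x : ℝ => Complex.exp (x * Complex.I) - 1 - x * Complex.I + (x : ℂ) ^ 2 / 2)
      (fun x _ => (hd x).continuousAt.continuousWithinAt)
      (fun x _ => (hd x).hasDerivWithinAt) (by simp) hB (fun x hx => ?_) ⟨hy, le_rfl⟩
    rw [norm_mul, Complex.norm_I, one_mul]
    exact norm_exp_mul_I_sub_one_sub_le x
  rcases le_total 0 y with hy | hy
  · rw [abs_of_nonneg hy]; exact key y hy
  · have h := key (-y) (by linarith)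
    rw [← Complex.norm_conj] at h
    rw [abs_of_nonpos hy]
    simpa [← Complex.exp_conj, sub_eq_add_neg, Complex.conj_ofNat] using h

/-- Second order expansion of `exp (i y)` with an error that is also at most quadratic. -/
lemma norm_exp_mul_I_sub_taylor_two_le_sq (y : ℝ) :
    ‖Complex.exp (y * Complex.I) - 1 - y * Complex.I + y ^ 2 / 2‖ ≤ y ^ 2 := by
  refine (norm_add_le _ _).trans ?_
  have h1 := norm_exp_mul_I_sub_one_sub_le y
  have h2 : ‖((y : ℂ) ^ 2 / 2)‖ = y ^ 2 / 2 := by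
    rw [norm_div, norm_pow, Complex.norm_real, Real.norm_eq_abs, sq_abs]; simp
  linarith

section

variable {ν : Measure ℝ} [IsProbabilityMeasure ν]

/-- The Taylor remainder is bounded cubically where `|x| ≤ c` and quadratically beyond, so second
moments suffice. The level `c` stays free: it is taken as `ε * s` for Lindeberg and as `K` for the
domination. -/
lemma norm_charFun_sub_taylor_le (hm : ∫ x, x ∂ν = 0) (hi : Integrable (fun x => x) ν)
    (hsq : Integrable (fun x => x ^ 2) ν) {c : ℝ} (hc : 0 ≤ c) (u : ℝ) :
    ‖charFun ν u - (1 - u ^ 2 * (∫ x, x ^ 2 ∂ν) / 2 : ℝ)‖ ≤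
      u ^ 2 * (|u| * c * (∫ x, x ^ 2 ∂ν) / 6 + ∫ x in {x | c < |x|}, x ^ 2 ∂ν) := by
  have hS : MeasurableSet {x : ℝ | c < |x|} := measurableSet_lt measurable_const (by fun_prop)
  have hexp : Integrable (fun x : ℝ => Complex.exp (u * x * Complex.I)) ν := by
    refine (integrable_const (1 : ℝ)).mono' (Continuous.aestronglyMeasurable (by fun_prop))
      (ae_of_all _ fun x => ?_)
    rw [Complex.norm_exp]; simp
  have hiC : Integrable (fun x : ℝ => ((u * x : ℝ) : ℂ) * Complex.I) ν :=
    ((hi.const_mul u).ofReal (𝕜 := ℂ)).mul_const _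
  have hsqC : Integrable (fun x : ℝ => ((u * x : ℝ) : ℂ) ^ 2 / 2) ν := by
    have := ((hsq.const_mul (u ^ 2 / 2)).ofReal (𝕜 := ℂ))
    refine this.congr (ae_of_all _ fun x => ?_)
    simp only [Complex.coe_algebraMap]
    push_cast; ring
  have e1 : charFun ν u - (1 - u ^ 2 * (∫ x, x ^ 2 ∂ν) / 2 : ℝ) =
      ∫ x, (Complex.exp ((u * x : ℝ) * Complex.I) - 1 - (u * x : ℝ) * Complex.I
        + ((u * x : ℝ) : ℂ) ^ 2 / 2) ∂ν := by
    have hexp' : Integrable (fun x : ℝ => Complex.exp ((u * x : ℝ) * Complex.I)) ν := by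
      simpa using hexp
    have hA : Integrable (fun x : ℝ => Complex.exp ((u * x : ℝ) * Complex.I) - 1) ν :=
      hexp'.sub (integrable_const 1)
    have hB : Integrable (fun x : ℝ => Complex.exp ((u * x : ℝ) * Complex.I) - 1 -
      (u * x : ℝ) * Complex.I) ν := hA.sub hiC
    rw [integral_add hB hsqC,
      integral_sub hA hiC,
      integral_sub hexp' (integrable_const 1), integral_mul_const, integral_complex_ofReal,
      integral_const_mul, hm, charFun_apply_real]
    have : ∫ x : ℝ, ((u * x : ℝ) : ℂ) ^ 2 / 2 ∂ν = ((u ^ 2 * (∫ x, x ^ 2 ∂ν) / 2 : ℝ) : ℂ) := by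
      rw [← integral_const_mul, ← integral_div, ← integral_complex_ofReal]
      refine integral_congr_ae (ae_of_all _ fun x => ?_)
      beta_reduce
      push_cast; ring
    rw [this]
    simp
    ring
  rw [e1]
  have hb : Integrable (fun x => u ^ 2 * (|u| * c / 6) * x ^ 2 +
      {x : ℝ | c < |x|}.indicator (fun x => u ^ 2 * x ^ 2) x) ν :=
    (hsq.const_mul _).add ((hsq.const_mul _).indicator hS)
  refine (norm_integral_le_of_norm_le hb (ae_of_all _ fun x => ?_)).trans (le_of_eq ?_)
  · by_cases hx : c < |x|
    · rw [Set.indicator_of_mem (show x ∈ {x : ℝ | c < |x|} from hx)]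
      have h1 := norm_exp_mul_I_sub_taylor_two_le_sq (u * x)
      have h2 : 0 ≤ u ^ 2 * (|u| * c / 6) * x ^ 2 := by positivity
      nlinarith
    · rw [Set.indicator_of_notMem (show x ∉ {x : ℝ | c < |x|} from hx), add_zero]
      refine (norm_exp_mul_I_sub_taylor_two_le (u * x)).trans ?_
      rw [abs_mul, mul_pow, pow_succ |x|, pow_succ |u|, sq_abs, sq_abs]
      have h1 : |x| ≤ c := not_lt.1 hx
      have h2 : u ^ 2 * |u| * x ^ 2 * |x| ≤ u ^ 2 * |u| * x ^ 2 * c := by gcongr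
      nlinarith
  · rw [integral_add (hsq.const_mul _) ((hsq.const_mul _).indicator hS), integral_const_mul,
      integral_indicator hS, integral_const_mul]
    ring

lemma second_moment_le_sq_add_tail (hsq : Integrable (fun x => x ^ 2) ν) (c : ℝ) :
    ∫ x, x ^ 2 ∂ν ≤ c ^ 2 + ∫ x in {x | c < |x|}, x ^ 2 ∂ν := by
  have hS : MeasurableSet {x : ℝ | c < |x|} := measurableSet_lt measurable_const (by fun_prop)
  rw [← integral_indicator hS]
  have : c ^ 2 = ∫ _, c ^ 2 ∂ν := by simp
  rw [this, ← integral_add (integrable_const _) (hsq.indicator hS)]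
  refine integral_mono hsq ((integrable_const _).add (hsq.indicator hS)) fun x => ?_
  by_cases hx : c < |x|
  · simp only [Set.indicator_of_mem (show x ∈ {x : ℝ | c < |x|} from hx)]
    nlinarith [sq_nonneg c]
  · simp only [Set.indicator_of_notMem (show x ∉ {x : ℝ | c < |x|} from hx), add_zero]
    exact sq_le_sq' (by linarith [neg_abs_le x, not_lt.1 hx]) (le_trans (le_abs_self x) (not_lt.1 hx))

/-- Gaussian type bound for a characteristic function near the origin, in terms of a truncated
second moment. -/
lemma norm_charFun_le_exp (hm : ∫ x, x ∂ν = 0) (hi : Integrable (fun x => x) ν)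
    (hsq : Integrable (fun x => x ^ 2) ν) {c u : ℝ} (hc : 0 ≤ c) (hu : |u| * c ≤ 1) :
    ‖charFun ν u‖ ≤
      Real.exp (-(u ^ 2 * ((∫ x, x ^ 2 ∂ν) / 3 - ∫ x in {x | c < |x|}, x ^ 2 ∂ν))) := by
  have ht : 0 ≤ ∫ x in {x | c < |x|}, x ^ 2 ∂ν := integral_nonneg fun _ => sq_nonneg _
  have hv : 0 ≤ ∫ x, x ^ 2 ∂ν := integral_nonneg fun _ => sq_nonneg _
  have htay := norm_charFun_sub_taylor_le hm hi hsq hc u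
  have hvt := second_moment_le_sq_add_tail hsq c
  set v := ∫ x, x ^ 2 ∂ν with hvdef
  set τ := ∫ x in {x | c < |x|}, x ^ 2 ∂ν with hτdef
  -- If `v ≤ 2c²`, then `u²v ≤ 2`, the main term is nonnegative, and `1/2 - 1/6 = 1/3` gives the
  -- exponent. Otherwise `τ ≥ v - c² > v/2`, so the right side is at least one.
  by_cases hcase : v ≤ 2 * c ^ 2
  · have huv : u ^ 2 * v ≤ 2 := by
      have h1 : u ^ 2 * v ≤ u ^ 2 * (2 * c ^ 2) := by gcongr
      have h2 : (|u| * c) ^ 2 ≤ 1 := pow_le_one₀ (by positivity) hu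
      rw [mul_pow, sq_abs] at h2
      linarith
    have h1 : ‖charFun ν u‖ ≤ (1 - u ^ 2 * v / 2) + u ^ 2 * (|u| * c * v / 6 + τ) := by
      have h2 := norm_le_norm_add_norm_sub' (charFun ν u) ((1 - u ^ 2 * v / 2 : ℝ) : ℂ)
      rw [Complex.norm_real, Real.norm_of_nonneg (by linarith)] at h2
      linarith
    have h3 : u ^ 2 * (|u| * c * v / 6 + τ) ≤ u ^ 2 * (1 * v / 6 + τ) := by gcongr
    have h4 := Real.add_one_le_exp (-(u ^ 2 * (v / 3 - τ)))
    nlinarith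
  · push Not at hcase
    refine (norm_charFun_le_one u).trans (Real.one_le_exp ?_)
    have : v / 3 - τ ≤ 0 := by linarith
    nlinarith [sq_nonneg u]

end

/-! ### Products of characteristic functions: small, moderate and large frequencies. -/

/-- A centered probability law on `ℝ` with finite second moment. -/
structure IsCenteredLaw (ν : Measure ℝ) : Prop where
  isProbabilityMeasure : IsProbabilityMeasure ν
  integral_eq_zero : ∫ x, x ∂ν = 0
  integrable_id : Integrable (fun x => x) ν
  integrable_sq : Integrable (fun x => x ^ 2) ν

lemma norm_prod_sub_prod_le_sum {ι : Type*} (s : Finset ι) {a b : ι → ℂ}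
    (ha : ∀ i ∈ s, ‖a i‖ ≤ 1) (hb : ∀ i ∈ s, ‖b i‖ ≤ 1) :
    ‖∏ i ∈ s, a i - ∏ i ∈ s, b i‖ ≤ ∑ i ∈ s, ‖a i - b i‖ := by
  classical
  induction s using Finset.induction with
  | empty => simp
  | insert i s hi ih =>
    rw [Finset.prod_insert hi, Finset.prod_insert hi, Finset.sum_insert hi]
    have h1 := ih (fun j hj => ha j (Finset.mem_insert_of_mem hj))
      (fun j hj => hb j (Finset.mem_insert_of_mem hj))
    have h2 : ‖∏ j ∈ s, b j‖ ≤ 1 := by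
      rw [norm_prod]
      exact Finset.prod_le_one (fun _ _ => norm_nonneg _)
        fun j hj => hb j (Finset.mem_insert_of_mem hj)
    calc ‖a i * ∏ j ∈ s, a j - b i * ∏ j ∈ s, b j‖
        = ‖a i * (∏ j ∈ s, a j - ∏ j ∈ s, b j) + (a i - b i) * ∏ j ∈ s, b j‖ := by
          congr 1; ring
      _ ≤ ‖a i‖ * ‖∏ j ∈ s, a j - ∏ j ∈ s, b j‖ + ‖a i - b i‖ * ‖∏ j ∈ s, b j‖ := by
          refine (norm_add_le _ _).trans ?_
          rw [norm_mul, norm_mul]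
      _ ≤ 1 * ‖∏ j ∈ s, a j - ∏ j ∈ s, b j‖ + ‖a i - b i‖ * 1 := by
          gcongr
          exact ha i (Finset.mem_insert_self i s)
      _ ≤ _ := by linarith

lemma abs_exp_neg_sub_one_add_le {a : ℝ} (ha : 0 ≤ a) : |Real.exp (-a) - (1 - a)| ≤ a ^ 2 := by
  have h1 := Real.add_one_le_exp (-a)
  rw [abs_of_nonneg (by linarith)]
  rcases le_total a 1 with h | h
  · have h2 := Real.abs_exp_sub_one_sub_id_le (x := -a) (by rwa [abs_neg, abs_of_nonneg ha])
    have h3 := le_abs_self (Real.exp (-a) - 1 - -a)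
    nlinarith
  · have : Real.exp (-a) ≤ 1 := Real.exp_le_one_iff.2 (by linarith)
    nlinarith

section

variable {ι : Type*} {I : Finset ι} {ν : ι → Measure ℝ}

/-- Quantitative form of the convergence of characteristic functions in the Lindeberg central
limit theorem. -/
lemma norm_prod_charFun_sub_exp_le (hν : ∀ i ∈ I, IsCenteredLaw (ν i))
    {s : ℝ} (hs : 0 < s) (hsum : ∑ i ∈ I, ∫ x, x ^ 2 ∂(ν i) = s ^ 2) {ε : ℝ} (hε : 0 < ε) (t : ℝ) :
    ‖∏ i ∈ I, charFun (ν i) (t / s) - (Real.exp (-t ^ 2 / 2) : ℝ)‖ ≤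
      |t| ^ 3 * ε / 6 + t ^ 2 * ((∑ i ∈ I, ∫ x in {x | ε * s < |x|}, x ^ 2 ∂(ν i)) / s ^ 2) +
      t ^ 4 / 4 * (ε ^ 2 + (∑ i ∈ I, ∫ x in {x | ε * s < |x|}, x ^ 2 ∂(ν i)) / s ^ 2) := by
  set v : ι → ℝ := fun i => ∫ x, x ^ 2 ∂(ν i) with hv
  set τ : ι → ℝ := fun i => ∫ x in {x | ε * s < |x|}, x ^ 2 ∂(ν i) with hτ
  set L := (∑ i ∈ I, τ i) / s ^ 2 with hL
  have hs2 : 0 < s ^ 2 := by positivity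
  have hv0 : ∀ i, 0 ≤ v i := fun i => integral_nonneg fun _ => sq_nonneg _
  have hτ0 : ∀ i, 0 ≤ τ i := fun i => integral_nonneg fun _ => sq_nonneg _
  have hexp : ((Real.exp (-t ^ 2 / 2) : ℝ) : ℂ) =
      ∏ i ∈ I, ((Real.exp (-((t / s) ^ 2 * v i / 2)) : ℝ) : ℂ) := by
    rw [← Complex.ofReal_prod, ← Real.exp_sum, Finset.sum_neg_distrib, ← Finset.sum_div,
      ← Finset.mul_sum, hsum]
    congr 2
    field_simp
  have hterm : ∀ i ∈ I, ‖charFun (ν i) (t / s) - (Real.exp (-((t / s) ^ 2 * v i / 2)) : ℝ)‖ ≤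
      |t| ^ 3 * ε / 6 * (v i / s ^ 2) + t ^ 2 * (τ i / s ^ 2) +
      t ^ 4 / 4 * (ε ^ 2 + L) * (v i / s ^ 2) := by
    intro i hi
    have := (hν i hi).isProbabilityMeasure
    have h1 := norm_charFun_sub_taylor_le (hν i hi).integral_eq_zero (hν i hi).integrable_id
      (hν i hi).integrable_sq (by positivity : 0 ≤ ε * s) (t / s)
    have h2 := abs_exp_neg_sub_one_add_le (a := (t / s) ^ 2 * v i / 2)
      (by have := hv0 i; positivity)
    have h3 := second_moment_le_sq_add_tail (hν i hi).integrable_sq (ε * s)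
    have h4 : τ i ≤ ∑ j ∈ I, τ j := Finset.single_le_sum (fun j _ => hτ0 j) hi
    -- No single variance dominates the row; this makes the sum of the quadratic errors small.
    have h5 : v i / s ^ 2 ≤ ε ^ 2 + L := by
      rw [hL, div_le_iff₀ hs2, add_mul, div_mul_cancel₀ _ hs2.ne']
      have : v i ≤ (ε * s) ^ 2 + τ i := h3
      nlinarith
    have h6 : ‖charFun (ν i) (t / s) - (Real.exp (-((t / s) ^ 2 * v i / 2)) : ℝ)‖ ≤
        (t / s) ^ 2 * (|t / s| * (ε * s) * v i / 6 + τ i) + ((t / s) ^ 2 * v i / 2) ^ 2 := by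
      have h7 := norm_sub_le_norm_sub_add_norm_sub (charFun (ν i) (t / s))
        ((1 - (t / s) ^ 2 * v i / 2 : ℝ) : ℂ) (Real.exp (-((t / s) ^ 2 * v i / 2)) : ℝ)
      refine h7.trans (add_le_add h1 ?_)
      rwa [← Complex.ofReal_sub, Complex.norm_real, Real.norm_eq_abs, abs_sub_comm]
    refine h6.trans ?_
    have h8 : ((t / s) ^ 2 * v i / 2) ^ 2 ≤ t ^ 4 / 4 * (ε ^ 2 + L) * (v i / s ^ 2) := by
      have : ((t / s) ^ 2 * v i / 2) ^ 2 = t ^ 4 / 4 * (v i / s ^ 2) * (v i / s ^ 2) := by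
        field_simp; norm_num
      rw [this]
      have := hv0 i
      gcongr
    have h9 : (t / s) ^ 2 * (|t / s| * (ε * s) * v i / 6 + τ i) =
        |t| ^ 3 * ε / 6 * (v i / s ^ 2) + t ^ 2 * (τ i / s ^ 2) := by
      rw [abs_div, abs_of_pos hs, div_pow, ← sq_abs t]
      field_simp
    linarith
  rw [hexp]
  refine (norm_prod_sub_prod_le_sum I (fun i hi => ?_) (fun i hi => ?_)).trans ?_
  · have := (hν i hi).isProbabilityMeasure
    exact norm_charFun_le_one _
  · rw [Complex.norm_real, Real.norm_of_nonneg (Real.exp_pos _).le, Real.exp_le_one_iff]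
    have : 0 ≤ (t / s) ^ 2 * v i / 2 := by have := hv0 i; positivity
    linarith
  · refine (Finset.sum_le_sum hterm).trans (le_of_eq ?_)
    rw [Finset.sum_add_distrib, Finset.sum_add_distrib, ← Finset.mul_sum, ← Finset.mul_sum,
      ← Finset.mul_sum, ← Finset.sum_div, ← Finset.sum_div, hsum, div_self hs2.ne']
    ring

/-- Gaussian domination of the characteristic function of a normalized sum. -/
lemma norm_prod_charFun_le_exp (hν : ∀ i ∈ I, IsCenteredLaw (ν i))
    {s : ℝ} (hs : 0 < s) {J : Finset ι} (hJ : J ⊆ I) {δ K : ℝ} (hK : 0 < K)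
    (hδ : δ * s ^ 2 ≤ ∑ i ∈ J, ∫ x, x ^ 2 ∂(ν i))
    (htail : ∑ i ∈ J, ∫ x in {x | K < |x|}, x ^ 2 ∂(ν i) ≤ (∑ i ∈ J, ∫ x, x ^ 2 ∂(ν i)) / 8)
    {t : ℝ} (ht : |t| ≤ s / K) :
    ‖∏ i ∈ I, charFun (ν i) (t / s)‖ ≤ Real.exp (-(δ / 8) * t ^ 2) := by
  have hu : |t / s| * K ≤ 1 := by
    rw [abs_div, abs_of_pos hs, div_mul_eq_mul_div, div_le_one hs]
    rwa [le_div_iff₀ hK] at ht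
  calc ‖∏ i ∈ I, charFun (ν i) (t / s)‖ = ∏ i ∈ I, ‖charFun (ν i) (t / s)‖ := norm_prod _ _
    _ ≤ ∏ i ∈ J, ‖charFun (ν i) (t / s)‖ := by
        refine Finset.prod_le_prod_of_subset_of_le_one hJ (fun _ _ => norm_nonneg _) ?_
        intro i hi _
        have := (hν i hi).isProbabilityMeasure
        exact norm_charFun_le_one _
    _ ≤ ∏ i ∈ J, Real.exp (-((t / s) ^ 2 * ((∫ x, x ^ 2 ∂(ν i)) / 3 -
          ∫ x in {x | K < |x|}, x ^ 2 ∂(ν i)))) := by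
        refine Finset.prod_le_prod (fun _ _ => norm_nonneg _) fun i hi => ?_
        have h := hν i (hJ hi)
        have := h.isProbabilityMeasure
        exact norm_charFun_le_exp h.integral_eq_zero h.integrable_id h.integrable_sq hK.le hu
    _ ≤ _ := by
        rw [← Real.exp_sum, Finset.sum_neg_distrib, ← Finset.mul_sum, Finset.sum_sub_distrib,
          ← Finset.sum_div]
        refine Real.exp_le_exp.2 ?_
        set B := ∑ i ∈ J, ∫ x, x ^ 2 ∂(ν i) with hB
        have hB0 : 0 ≤ B := Finset.sum_nonneg fun i _ => integral_nonneg fun _ => sq_nonneg _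
        -- The constant in the domination comes from `1/3 - 1/8 ≥ 1/8`.
        have h1 : B / 8 ≤ B / 3 - ∑ i ∈ J, ∫ x in {x | K < |x|}, x ^ 2 ∂(ν i) := by linarith
        have h2 : (t / s) ^ 2 * (δ * s ^ 2) = δ * t ^ 2 := by field_simp
        have h3 : (t / s) ^ 2 * (δ * s ^ 2) ≤ (t / s) ^ 2 * B := by gcongr
        have h4 := mul_le_mul_of_nonneg_left h1 (sq_nonneg (t / s))
        linarith

lemma lintegral_comp_div_const {F : ℝ → ENNReal} (hF : Measurable F) {s : ℝ} (hs : 0 < s) :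
    ∫⁻ t, F (t / s) = ENNReal.ofReal s * ∫⁻ t, F t := by
  have h := lintegral_map (μ := volume) hF (measurable_const_mul s⁻¹)
  rw [Real.map_volume_mul_left (inv_ne_zero hs.ne'), lintegral_smul_measure, inv_inv,
    abs_of_pos hs, smul_eq_mul] at h
  rw [h]
  simp_rw [div_eq_inv_mul]

/-- Contribution of large frequencies. -/
lemma setLIntegral_prod_charFun_le (hν : ∀ i ∈ I, IsCenteredLaw (ν i)) {s T q : ℝ} (hs : 0 < s)
    {A D : Finset ι} (hA : A ⊆ I) (hD : D ⊆ I) (hAD : Disjoint A D)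
    (hq : ∀ i ∈ D, ∀ t : ℝ, T < |t| → ‖charFun (ν i) (t / s)‖ ≤ 1 - q) {C : ℝ}
    (hint : ∫⁻ t, ∏ i ∈ A, ‖charFun (ν i) t‖ₑ ≤ ENNReal.ofReal C) :
    ∫⁻ t in {t | T < |t|}, ‖∏ i ∈ I, charFun (ν i) (t / s)‖ₑ ≤
      ENNReal.ofReal (Real.exp (-(q * D.card)) * (s * C)) := by
  classical
  have hprob : ∀ i ∈ I, IsProbabilityMeasure (ν i) := fun i hi => (hν i hi).isProbabilityMeasure
  have hmeas : ∀ i ∈ I, Measurable (fun t => ‖charFun (ν i) t‖ₑ) := fun i hi => by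
    have := hprob i hi
    exact measurable_charFun.enorm
  have hAm : Measurable fun t => ∏ i ∈ A, ‖charFun (ν i) t‖ₑ :=
    Finset.measurable_fun_prod _ fun i hi => hmeas i (hA hi)
  -- Factors in `D` give exponential decay, factors in `A` are kept for integrability, and all
  -- others are bounded by one.
  have hbound : ∀ t : ℝ, T < |t| → ‖∏ i ∈ I, charFun (ν i) (t / s)‖ₑ ≤
      ENNReal.ofReal (Real.exp (-(q * D.card))) * ∏ i ∈ A, ‖charFun (ν i) (t / s)‖ₑ := by
    intro t ht
    have h1 : ‖∏ i ∈ I, charFun (ν i) (t / s)‖ ≤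
        Real.exp (-(q * D.card)) * ∏ i ∈ A, ‖charFun (ν i) (t / s)‖ := by
      rw [norm_prod]
      calc ∏ i ∈ I, ‖charFun (ν i) (t / s)‖ ≤ ∏ i ∈ A ∪ D, ‖charFun (ν i) (t / s)‖ := by
            refine Finset.prod_le_prod_of_subset_of_le_one (Finset.union_subset hA hD)
              (fun _ _ => norm_nonneg _) ?_
            intro i hi _
            have := hprob i hi
            exact norm_charFun_le_one _
        _ = (∏ i ∈ D, ‖charFun (ν i) (t / s)‖) * ∏ i ∈ A, ‖charFun (ν i) (t / s)‖ := by
            rw [Finset.prod_union hAD, mul_comm]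
        _ ≤ _ := by
            refine mul_le_mul_of_nonneg_right ?_ (Finset.prod_nonneg fun _ _ => norm_nonneg _)
            calc ∏ i ∈ D, ‖charFun (ν i) (t / s)‖ ≤ ∏ i ∈ D, Real.exp (-q) := by
                  refine Finset.prod_le_prod (fun _ _ => norm_nonneg _) fun i hi => ?_
                  have := Real.add_one_le_exp (-q)
                  have := hq i hi t ht
                  linarith
              _ = _ := by
                  rw [Finset.prod_const, ← Real.exp_nat_mul]
                  congr 1; ring
    rw [← ofReal_norm]
    refine (ENNReal.ofReal_le_ofReal h1).trans (le_of_eq ?_)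
    rw [ENNReal.ofReal_mul (Real.exp_pos _).le,
      ENNReal.ofReal_prod_of_nonneg fun _ _ => norm_nonneg _]
    simp_rw [ofReal_norm]
  have hAms : Measurable fun t => ∏ i ∈ A, ‖charFun (ν i) (t / s)‖ₑ :=
    hAm.comp (measurable_id.div_const s)
  calc ∫⁻ t in {t | T < |t|}, ‖∏ i ∈ I, charFun (ν i) (t / s)‖ₑ
      ≤ ∫⁻ t in {t | T < |t|}, ENNReal.ofReal (Real.exp (-(q * D.card))) *
          ∏ i ∈ A, ‖charFun (ν i) (t / s)‖ₑ :=
        setLIntegral_mono (hAms.const_mul _) hbound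
    _ ≤ ∫⁻ t, ENNReal.ofReal (Real.exp (-(q * D.card))) *
          ∏ i ∈ A, ‖charFun (ν i) (t / s)‖ₑ := setLIntegral_le_lintegral _ _
    _ ≤ _ := by
        rw [lintegral_const_mul _ hAms, lintegral_comp_div_const hAm hs,
          ENNReal.ofReal_mul (Real.exp_pos _).le, ENNReal.ofReal_mul hs.le]
        gcongr

end

/-- If the characteristic functions `ψ n` converge pointwise to that of the Gaussian, are
dominated on `[-T n, T n]` and negligible outside, then they converge in `L¹`. -/
lemma tendsto_lintegral_enorm_sub_exp {ψ : ℕ → ℝ → ℂ} {T : ℕ → ℝ} {δ : ℝ} (hδ : 0 < δ)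
    (hψ : ∀ n, Measurable (ψ n))
    (hpt : ∀ t : ℝ, Tendsto (fun n => ψ n t) atTop (𝓝 ((Real.exp (-t ^ 2 / 2) : ℝ) : ℂ)))
    (hdom : ∀ᶠ n in atTop, ∀ t : ℝ, |t| ≤ T n → ‖ψ n t‖ ≤ Real.exp (-δ * t ^ 2))
    (htail : Tendsto (fun n => ∫⁻ t in {t | T n < |t|}, ‖ψ n t‖ₑ) atTop (𝓝 0))
    (hT : Tendsto T atTop atTop) :
    Tendsto (fun n => ∫⁻ t : ℝ, ‖ψ n t - (Real.exp (-t ^ 2 / 2) : ℝ)‖ₑ) atTop (𝓝 0) := by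
  set S : ℕ → Set ℝ := fun n => {t | T n < |t|} with hS
  have hSm : ∀ n, MeasurableSet (S n) := fun n =>
    measurableSet_lt measurable_const (by fun_prop)
  set g : ℝ → ℂ := fun t => (Real.exp (-t ^ 2 / 2) : ℝ) with hg
  have hgm : Measurable g := by fun_prop
  -- Only the truncation to `[-T n, T n]` has an integrable majorant; the tail is added back at the
  -- end.
  set χ : ℕ → ℝ → ℂ := fun n => (S n)ᶜ.indicator (ψ n) with hχ
  have hmain : Tendsto (fun n => ∫⁻ t, ‖χ n t - g t‖ₑ) atTop (𝓝 0) := by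
    rw [← lintegral_zero (μ := (volume : Measure ℝ))]
    refine tendsto_lintegral_filter_of_dominated_convergence
      (fun t => ENNReal.ofReal (Real.exp (-δ * t ^ 2) + Real.exp (-(1 / 2) * t ^ 2))) ?_ ?_ ?_ ?_
    · exact Eventually.of_forall fun n => (((hψ n).indicator (hSm n).compl).sub hgm).enorm
    · filter_upwards [hdom] with n hn
      refine ae_of_all _ fun t => ?_
      rw [← ofReal_norm]
      refine ENNReal.ofReal_le_ofReal ((norm_sub_le _ _).trans (add_le_add ?_ ?_))
      · by_cases ht : t ∈ (S n)ᶜ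
        · simp only [hχ, Set.indicator_of_mem ht]
          exact hn t (not_lt.1 ht)
        · simp only [hχ, Set.indicator_of_notMem ht, norm_zero]
          exact (Real.exp_pos _).le
      · rw [hg, Complex.norm_real, Real.norm_of_nonneg (Real.exp_pos _).le]
        exact le_of_eq (by congr 1; ring)
    · have hi := (integrable_exp_neg_mul_sq hδ).add
        (integrable_exp_neg_mul_sq (b := 1 / 2) (by norm_num))
      have := hi.lintegral_lt_top
      exact this.ne
    · refine ae_of_all _ fun t => ?_
      have h1 : Tendsto (fun n => ψ n t - g t) atTop (𝓝 0) := by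
        rw [← sub_self (g t)]
        exact (hpt t).sub_const (g t)
      have h2 : Tendsto (fun n => ‖ψ n t - g t‖ₑ) atTop (𝓝 0) := by
        simpa using h1.enorm
      refine h2.congr' ?_
      filter_upwards [hT.eventually_ge_atTop |t|] with n hn
      have ht : t ∈ (S n)ᶜ := not_lt.2 hn
      simp only [hχ, Set.indicator_of_mem ht]
  refine tendsto_of_tendsto_of_tendsto_of_le_of_le tendsto_const_nhds
    (by simpa using hmain.add htail) (fun _ => zero_le) fun n => ?_
  have hχm : Measurable fun t => ‖χ n t - g t‖ₑ :=
    (((hψ n).indicator (hSm n).compl).sub hgm).enorm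
  rw [← lintegral_indicator (hSm n), ← lintegral_add_left hχm]
  refine lintegral_mono fun t => ?_
  by_cases ht : t ∈ S n
  · simp only [hχ, Set.indicator_of_mem ht,
      Set.indicator_of_notMem (show t ∉ (S n)ᶜ from fun h => h ht)]
    rw [zero_sub, enorm_neg, add_comm]
    exact enorm_sub_le
  · simp only [hχ, Set.indicator_of_notMem ht,
      Set.indicator_of_mem (show t ∈ (S n)ᶜ from ht), add_zero]
    exact le_rfl

/-! ### Laws of the array, pointwise inversion and growth rates. -/

section Laws

variable {Ω : Type*} [MeasurableSpace Ω] {P : Measure Ω} {Y : Ω → ℝ}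

lemma isCenteredLaw_map [IsProbabilityMeasure P] (hY : Measurable Y) (h0 : ∫ ω, Y ω ∂P = 0) (hsq : MemLp Y 2 P) :
    IsCenteredLaw (P.map Y) where
  isProbabilityMeasure := Measure.isProbabilityMeasure_map hY.aemeasurable
  integral_eq_zero := by
    rw [integral_map hY.aemeasurable (by fun_prop)]; exact h0
  integrable_id := by
    rw [integrable_map_measure (by fun_prop) hY.aemeasurable]
    exact hsq.integrable one_le_two
  integrable_sq := by
    rw [integrable_map_measure (by fun_prop) hY.aemeasurable]
    exact hsq.integrable_sq

lemma integral_sq_map_eq_variance (hY : Measurable Y) (h0 : ∫ ω, Y ω ∂P = 0) :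
    ∫ x, x ^ 2 ∂(P.map Y) = variance Y P := by
  rw [variance_of_integral_eq_zero hY.aemeasurable h0,
    integral_map hY.aemeasurable (by fun_prop)]

lemma setIntegral_sq_map_eq_tailSecondMoment (hY : Measurable Y) (c : ℝ) :
    ∫ x in {x | c < |x|}, x ^ 2 ∂(P.map Y) = tailSecondMoment P Y c := by
  rw [setIntegral_map (measurableSet_lt measurable_const (by fun_prop)) (by fun_prop)
    hY.aemeasurable]
  rfl

end Laws

section Inversion

variable {Ω : Type*} [MeasurableSpace Ω] {P : Measure Ω}
  {X : ℕ → Ω → ℝ} {f : ℕ → ℝ → ℝ} {n : ℕ}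

lemma charFun_map_sum_Icc (hX : ∀ i ∈ Finset.Icc 1 n, Measurable (X i))
    (hind : iIndepFun (fun i : Finset.Icc 1 n => X i) P) {k : ℕ} (hkn : k ≤ n) (t : ℝ) :
    charFun (P.map fun ω => ∑ i ∈ Finset.Icc 1 k, X i ω) t =
      ∏ i ∈ Finset.Icc 1 k, charFun (P.map (X i)) t := by
  have hsub : ∀ i ∈ Finset.Icc 1 k, i ∈ Finset.Icc 1 n := by
    intro i hi; simp at hi ⊢; omega
  have h : iIndepFun ((Finset.Icc 1 k).restrict X) P :=
    hind.precomp (g := fun i : Finset.Icc 1 k => (⟨i.1, hsub i.1 i.2⟩ : Finset.Icc 1 n))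
      (fun a b hab => Subtype.ext (congrArg (fun z : Finset.Icc 1 n => (z : ℕ)) hab))
  rw [h.charFun_map_fun_finsetSum_eq_prod fun i hi => (hX i (hsub i hi)).aemeasurable,
    Finset.prod_apply]

lemma integrable_prod_charFun {ι : Type*} {I A : Finset ι} {ν : ι → Measure ℝ}
    (hν : ∀ i ∈ I, IsProbabilityMeasure (ν i)) (hA : A ⊆ I)
    (hint : ∫⁻ t, ∏ i ∈ A, ‖charFun (ν i) t‖ₑ < ⊤) :
    Integrable fun t => ∏ i ∈ I, charFun (ν i) t := by
  refine ⟨(Finset.measurable_fun_prod _ fun i hi => ?_).aestronglyMeasurable, ?_⟩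
  · have := hν i hi
    exact measurable_charFun
  · refine lt_of_le_of_lt (lintegral_mono fun t => ?_) hint
    have h : ‖∏ i ∈ I, charFun (ν i) t‖ ≤ ∏ i ∈ A, ‖charFun (ν i) t‖ := by
      rw [norm_prod]
      refine Finset.prod_le_prod_of_subset_of_le_one hA (fun _ _ => norm_nonneg _) ?_
      intro i hi _
      have := hν i hi
      exact norm_charFun_le_one _
    rw [← ofReal_norm]
    refine (ENNReal.ofReal_le_ofReal h).trans (le_of_eq ?_)
    rw [ENNReal.ofReal_prod_of_nonneg fun _ _ => norm_nonneg _]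
    simp_rw [ofReal_norm]

/-- Inversion formula, at every point, for the rescaled iterated convolution. -/
lemma mul_iterConv_eq_integral [IsProbabilityMeasure P]
    (hX : ∀ i ∈ Finset.Icc 1 n, Measurable (X i))
    (hind : iIndepFun (fun i : Finset.Icc 1 n => X i) P)
    (hf : ∀ i ∈ Finset.Icc 1 n, IsDensityOf P (X i) (f i)) (hn : 2 ≤ n)
    {A : Finset ℕ} (hA : A ⊆ Finset.Icc 1 (n - 1))
    (hint : ∫⁻ t, ∏ i ∈ A, ‖charFun (P.map (X i)) t‖ₑ < ⊤) {s : ℝ} (hs : 0 < s) (x : ℝ) :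
    ((s * iterConv f n (s * x) : ℝ) : ℂ) = (2 * Real.pi : ℝ)⁻¹ •
      ∫ t : ℝ, Complex.exp (-(t * x) * Complex.I) *
        ∏ i ∈ Finset.Icc 1 n, charFun (P.map (X i)) (t / s) := by
  obtain ⟨j, rfl⟩ : ∃ j, n = j + 2 := ⟨n - 2, by omega⟩
  have hj : j + 2 - 1 = j + 1 := by omega
  rw [hj] at hA
  have hmem : j + 2 ∈ Finset.Icc 1 (j + 2) := by simp
  have hsub : ∀ i ∈ Finset.Icc 1 (j + 1), i ∈ Finset.Icc 1 (j + 2) := by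
    intro i hi; simp at hi ⊢; omega
  have hS : Measurable fun ω => ∑ i ∈ Finset.Icc 1 (j + 1), X i ω :=
    Finset.measurable_sum _ fun i hi => hX i (hsub i hi)
  have hchar : charFun (P.map fun ω => ∑ i ∈ Finset.Icc 1 (j + 1), X i ω) =
      fun t => ∏ i ∈ Finset.Icc 1 (j + 1), charFun (P.map (X i)) t := by
    ext t; exact charFun_map_sum_Icc hX hind (by omega) t
  have hi : Integrable (charFun (P.map fun ω => ∑ i ∈ Finset.Icc 1 (j + 1), X i ω)) := by
    rw [hchar]
    exact integrable_prod_charFun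
      (fun i hi => Measure.isProbabilityMeasure_map (hX i (hsub i hi)).aemeasurable) hA hint
  -- Splitting off the last density yields the formula at every point; the integrability must then
  -- come from the first `n - 1` factors.
  have hinv := (isDensityOf_iterConv hX hind hf (by omega : 1 ≤ j + 1)
    (by omega)).convolution_eq_integral_charFun hS (hf _ hmem) (hX _ hmem) hi (s * x)
  rw [Complex.ofReal_mul, iterConv.eq_3, hinv, hchar]
  have hscale := Measure.integral_comp_div (fun t : ℝ => Complex.exp (-(t * (s * x : ℝ)) *
    Complex.I) * ∏ i ∈ Finset.Icc 1 (j + 2), charFun (P.map (X i)) t) s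
  have hprod : ∀ t, (∏ i ∈ Finset.Icc 1 (j + 1), charFun (P.map (X i)) t) *
      charFun (P.map (X (j + 2))) t = ∏ i ∈ Finset.Icc 1 (j + 2), charFun (P.map (X i)) t :=
    fun t => (Finset.prod_Icc_succ_top (by omega) _).symm
  simp_rw [hprod]
  rw [abs_of_pos hs] at hscale
  rw [← Complex.real_smul, smul_comm, ← hscale]
  congr 1
  refine integral_congr_ae (ae_of_all _ fun t => ?_)
  beta_reduce
  congr 2
  have : (s : ℂ) ≠ 0 := by exact_mod_cast hs.ne'
  push_cast
  field_simp

end Inversion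

/-- Up to `√(2π)` the standard normal density is its own characteristic function, here evaluated at
`-x`. -/
lemma gaussian_density_eq_integral (x : ℝ) :
    ((1 / Real.sqrt (2 * Real.pi) * Real.exp (-x ^ 2 / 2) : ℝ) : ℂ) = (2 * Real.pi : ℝ)⁻¹ •
      ∫ t : ℝ, Complex.exp (-(t * x) * Complex.I) * (Real.exp (-t ^ 2 / 2) : ℝ) := by
  have h := charFun_gaussianReal (μ := 0) (v := 1) (-x)
  rw [charFun_apply_real, integral_gaussianReal_eq_integral_smul one_ne_zero] at h
  have h2 : ∫ t : ℝ, Complex.exp (-(t * x) * Complex.I) * (Real.exp (-t ^ 2 / 2) : ℝ) =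
      (Real.sqrt (2 * Real.pi) : ℝ) • ∫ t : ℝ, gaussianPDFReal 0 1 t •
        Complex.exp ((-x : ℝ) * t * Complex.I) := by
    rw [← integral_smul]
    refine integral_congr_ae (ae_of_all _ fun t => ?_)
    simp only [gaussianPDFReal, NNReal.coe_one, mul_one, sub_zero]
    have hpos : Real.sqrt (2 * Real.pi) ≠ 0 := (Real.sqrt_pos.2 (by positivity)).ne'
    rw [smul_smul, ← mul_assoc, mul_inv_cancel₀ hpos, one_mul, Complex.real_smul, mul_comm]
    congr 2
    push_cast; ring
  rw [h2, h, smul_smul]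
  have h3 : (2 * Real.pi)⁻¹ * Real.sqrt (2 * Real.pi) = 1 / Real.sqrt (2 * Real.pi) := by
    have hpos : 0 < 2 * Real.pi := by positivity
    have := Real.mul_self_sqrt hpos.le
    have hs := Real.sqrt_pos.2 hpos
    field_simp
    rw [sq]; linarith
  rw [h3, Complex.real_smul, Complex.ofReal_mul, Complex.ofReal_exp]
  congr 2
  push_cast; ring

/-- Comparison of two inverse Fourier integrals. -/
lemma enorm_sub_le_lintegral_of_eq_integral {a b : ℝ} {ψ g : ℝ → ℂ} {x : ℝ} (hψ : Integrable ψ)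
    (hg : Integrable g)
    (ha : (a : ℂ) = (2 * Real.pi : ℝ)⁻¹ • ∫ t : ℝ, Complex.exp (-(t * x) * Complex.I) * ψ t)
    (hb : (b : ℂ) = (2 * Real.pi : ℝ)⁻¹ • ∫ t : ℝ, Complex.exp (-(t * x) * Complex.I) * g t) :
    ‖a - b‖ₑ ≤ ∫⁻ t, ‖ψ t - g t‖ₑ := by
  have hexp : ∀ t : ℝ, ‖Complex.exp (-(t * x) * Complex.I)‖ = 1 := by
    intro t; rw [Complex.norm_exp]; simp
  have hI : ∀ {h : ℝ → ℂ}, Integrable h →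
      Integrable fun t : ℝ => Complex.exp (-(t * x) * Complex.I) * h t := by
    intro h hh
    refine hh.norm.mono' ((Continuous.aestronglyMeasurable (by fun_prop)).mul hh.1)
      (ae_of_all _ fun t => ?_)
    rw [norm_mul, hexp, one_mul]
  have h1 : ((a - b : ℝ) : ℂ) = (2 * Real.pi : ℝ)⁻¹ •
      ∫ t : ℝ, Complex.exp (-(t * x) * Complex.I) * (ψ t - g t) := by
    rw [Complex.ofReal_sub, ha, hb, ← smul_sub, ← integral_sub (hI hψ) (hI hg)]
    simp_rw [mul_sub]
  have h2 : ‖a - b‖ₑ = ‖((a - b : ℝ) : ℂ)‖ₑ := by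
    rw [← ofReal_norm, ← ofReal_norm, Complex.norm_real]
  rw [h2, h1, enorm_smul]
  have h3 : ‖(2 * Real.pi : ℝ)⁻¹‖ₑ ≤ 1 := by
    rw [Real.enorm_eq_ofReal (by positivity), ENNReal.ofReal_le_one]
    exact inv_le_one_of_one_le₀ (by nlinarith [Real.pi_gt_three])
  refine (mul_le_of_le_one_left' h3).trans ((enorm_integral_le_lintegral_enorm _).trans ?_)
  refine lintegral_mono fun t => ?_
  rw [enorm_mul, ← ofReal_norm (Complex.exp _), hexp, ENNReal.ofReal_one, one_mul]

/-- Growth of the cut-off frequency and decay of the large frequency bound. -/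
lemma tendsto_of_log_isLittleO {R K σ : ℕ → ℝ} {l : ℕ → ℕ} {v c : ℝ} (hv : 0 < v) (hc : 0 < c)
    (hR : ∀ n : ℕ, n * v ≤ R n) (hK : ∀ᶠ n in atTop, 1 ≤ K n) (hl : ∀ᶠ n in atTop, l n ≤ n)
    (ho : (fun n => Real.log (R n)) =o[atTop]
      (fun n => ((n : ℝ) - (l n : ℝ)) / max (σ n) (K n ^ 2))) :
    Tendsto (fun n => Real.sqrt (R n) / K n) atTop atTop ∧
    Tendsto (fun n => Real.exp (-(c / max (σ n) (K n ^ 2) * ((n : ℝ) - l n))) * Real.sqrt (R n))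
      atTop (𝓝 0) := by
  have hRtop : Tendsto R atTop atTop :=
    tendsto_atTop_mono hR (tendsto_natCast_atTop_atTop.atTop_mul_const hv)
  have hlog : Tendsto (fun n => Real.log (R n)) atTop atTop := Real.tendsto_log_atTop.comp hRtop
  have hbound : ∀ ε : ℝ, 0 < ε → ∀ᶠ n in atTop,
      Real.log (R n) ≤ ε * (((n : ℝ) - l n) / max (σ n) (K n ^ 2)) := by
    intro ε hε
    filter_upwards [ho.bound hε, hl, hK] with n h1 h2 h3
    have h4 : (l n : ℝ) ≤ n := by exact_mod_cast h2
    have h5 : 0 ≤ ((n : ℝ) - l n) / max (σ n) (K n ^ 2) :=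
      div_nonneg (by linarith) (le_max_of_le_right (by positivity))
    rw [Real.norm_of_nonneg h5] at h1
    exact (le_abs_self _).trans h1
  constructor
  · have h1 : Tendsto (fun n => Real.sqrt (v * Real.log (R n))) atTop atTop :=
      Real.tendsto_sqrt_atTop.comp (hlog.const_mul_atTop hv)
    refine tendsto_atTop_mono' _ ?_ h1
    filter_upwards [hbound 1 one_pos, hK, hlog.eventually_ge_atTop 1] with n h2 h3 h4
    have hK0 : 0 < K n := by linarith
    rw [le_div_iff₀ hK0]
    refine Real.le_sqrt_of_sq_le ?_
    rw [mul_pow, Real.sq_sqrt (by positivity)]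
    -- With `ε = 1`, condition (c) gives `K² log R ≤ n`; since `n * v ≤ R`, this yields `v log R ≤ R
    -- / K²`.
    have hmax : K n ^ 2 ≤ max (σ n) (K n ^ 2) := le_max_right _ _
    have h5 : Real.log (R n) * K n ^ 2 ≤ n := by
      rw [one_mul, le_div_iff₀ (by positivity)] at h2
      have : Real.log (R n) * K n ^ 2 ≤ Real.log (R n) * max (σ n) (K n ^ 2) := by gcongr
      have : (0 : ℝ) ≤ l n := Nat.cast_nonneg _
      linarith
    have := hR n
    nlinarith
  · have h0 : Tendsto (fun n => (Real.sqrt (R n))⁻¹) atTop (𝓝 0) :=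
      tendsto_inv_atTop_zero.comp (Real.tendsto_sqrt_atTop.comp hRtop)
    refine tendsto_of_tendsto_of_tendsto_of_le_of_le' tendsto_const_nhds h0
      (Eventually.of_forall fun n => by positivity) ?_
    -- With `ε = c` the exponential is at most `1 / R`, leaving `1 / √R` after multiplication by
    -- `√R`.
    filter_upwards [hbound c hc, hRtop.eventually_gt_atTop 0] with n h1 h2
    have hs : 0 < Real.sqrt (R n) := Real.sqrt_pos.2 h2
    have h3 : Real.exp (-(c / max (σ n) (K n ^ 2) * ((n : ℝ) - l n))) ≤ (R n)⁻¹ := by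
      rw [← Real.exp_log (inv_pos.2 h2), Real.log_inv]
      refine Real.exp_le_exp.2 (neg_le_neg (h1.trans (le_of_eq ?_)))
      ring
    refine (mul_le_mul_of_nonneg_right h3 hs.le).trans (le_of_eq ?_)
    have := Real.mul_self_sqrt h2.le
    rw [inv_mul_eq_div, div_eq_iff h2.ne', inv_mul_eq_div, eq_div_iff hs.ne', this]

/-! ### The local limit theorem. -/

theorem proposition3p3
    {Ω : ℕ → Type*} [∀ n, MeasurableSpace (Ω n)]
    (P : ∀ n, Measure (Ω n)) [∀ n, IsProbabilityMeasure (P n)]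
    -- the array: `X n i` is `X_{i,n}`, with density `f n i`; only `1 ≤ i ≤ n` matters
    (X : ∀ n, ℕ → Ω n → ℝ) (f : ℕ → ℕ → ℝ → ℝ)
    (hX_meas : ∀ n, ∀ i ∈ Finset.Icc 1 n, Measurable (X n i))
    (hX_indep : ∀ n, iIndepFun (fun i : Finset.Icc 1 n => X n i) (P n))
    (hX_centered : ∀ n, ∀ i ∈ Finset.Icc 1 n, ∫ ω, X n i ω ∂(P n) = 0)
    (hf : ∀ n, ∀ i ∈ Finset.Icc 1 n, IsDensityOf (P n) (X n i) (f n i))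
    -- 1. uniform bound in `L^r`
    (r : ℝ) (hr₁ : 1 < r) (hr₂ : r ≤ 2) (M : ℝ)
    (hfM : ∀ n, ∀ i ∈ Finset.Icc 1 n,
      eLpNorm (f n i) (ENNReal.ofReal r) volume ≤ ENNReal.ofReal M)
    -- 2. finite variances, in decreasing order along each row
    (hX_sq : ∀ n, ∀ i ∈ Finset.Icc 1 n, MemLp (X n i) 2 (P n))
    (hX_order : ∀ n, AntitoneOn (fun i => variance (X n i) (P n)) (Set.Icc 1 n))
    -- 3. Lindeberg's condition
    (hLindeberg : ∀ ε : ℝ, 0 < ε →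
      Tendsto (fun n => (∑ i ∈ Finset.Icc 1 n,
        tailSecondMoment (P n) (X n i) (ε * rowSD P X n)) / rowVar P X n) atTop (𝓝 0))
    -- 4. the quantitative tail and variance conditions; `lₗ` is `l_*` and `lᵤ` is `l^*`
    (δ : ℝ) (hδ : 0 < δ) (K : ℕ → ℝ) (lₗ lᵤ : ℕ → ℕ)
    (hK : ∀ᶠ n in atTop, 1 ≤ K n)
    (hlₗ : ∀ᶠ n in atTop, 1 ≤ lₗ n)
    (hlᵤ : ∀ᶠ n in atTop, 2 * ⌈r / (r - 1)⌉₊ ≤ lᵤ n ∧ lᵤ n ≤ n)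
    (ha : ∀ᶠ n in atTop,
      δ ≤ (∑ i ∈ Finset.Icc (lₗ n) n, variance (X n i) (P n)) / rowVar P X n)
    (hb : ∀ᶠ n in atTop,
      (∑ i ∈ Finset.Icc (lₗ n) n, tailSecondMoment (P n) (X n i) (K n)) /
        (∑ i ∈ Finset.Icc (lₗ n) n, variance (X n i) (P n)) ≤ 1 / 8)
    (hc : (fun n => Real.log (rowVar P X n)) =o[atTop]
      (fun n => ((n : ℝ) - (lᵤ n : ℝ)) / max (variance (X n (lᵤ n)) (P n)) (K n ^ 2))) :
    -- the convolution is the density of the row sum, and its rescaling that of the normalized sum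
    (∀ n, 1 ≤ n →
      IsDensityOf (P n) (fun ω => ∑ i ∈ Finset.Icc 1 n, X n i ω) (iterConv (f n) n) ∧
      IsDensityOf (P n) (fun ω => (∑ i ∈ Finset.Icc 1 n, X n i ω) / rowSD P X n)
        (fun x => rowSD P X n * iterConv (f n) n (rowSD P X n * x))) ∧
    -- uniform convergence on `ℝ` to the standard normal density
    TendstoUniformly
      (fun n x => rowSD P X n * iterConv (f n) n (rowSD P X n * x))
      (fun x => 1 / Real.sqrt (2 * Real.pi) * Real.exp (-x ^ 2 / 2)) atTop := by
  set M' : ℝ := max M 1 with hM'def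
  have hM' : 0 < M' := lt_of_lt_of_le one_pos (le_max_right _ _)
  have hfM' : ∀ n, ∀ i ∈ Finset.Icc 1 n,
      eLpNorm (f n i) (ENNReal.ofReal r) volume ≤ ENNReal.ofReal M' := fun n i hi =>
    (hfM n i hi).trans (ENNReal.ofReal_le_ofReal (le_max_left _ _))
  set ν : ℕ → ℕ → Measure ℝ := fun n i => (P n).map (X n i) with hνdef
  have hν : ∀ n, ∀ i ∈ Finset.Icc 1 n, IsCenteredLaw (ν n i) := fun n i hi =>
    isCenteredLaw_map (hX_meas n i hi) (hX_centered n i hi) (hX_sq n i hi)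
  have hvar : ∀ n, ∀ i ∈ Finset.Icc 1 n, ∫ x, x ^ 2 ∂(ν n i) = variance (X n i) (P n) :=
    fun n i hi => integral_sq_map_eq_variance (hX_meas n i hi) (hX_centered n i hi)
  have htl : ∀ n, ∀ i ∈ Finset.Icc 1 n, ∀ c,
      ∫ x in {x | c < |x|}, x ^ 2 ∂(ν n i) = tailSecondMoment (P n) (X n i) c :=
    fun n i hi c => setIntegral_sq_map_eq_tailSecondMoment (hX_meas n i hi) c
  have ha0 : 0 < uniformScale r M' := uniformScale_pos hM'
  set v₀ := uniformScale r M' ^ 2 / 16 with hv₀def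
  have hv₀ : 0 < v₀ := by positivity
  set c₀ := uniformScale r M' ^ 2 / (64 * Real.pi ^ 2) with hc₀def
  have hc₀ : 0 < c₀ := by positivity
  have hvar_lower : ∀ n, ∀ i ∈ Finset.Icc 1 n, v₀ ≤ variance (X n i) (P n) := fun n i hi => by
    rw [← hvar n i hi]
    exact (hf n i hi).le_second_moment (hX_meas n i hi) hr₁ hM' (hfM' n i hi)
      (hν n i hi).integrable_sq
  have hR : ∀ n : ℕ, n * v₀ ≤ rowVar P X n := fun n => by
    have := Finset.card_nsmul_le_sum (Finset.Icc 1 n) _ _ (hvar_lower n)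
    simpa [rowVar] using this
  have hs : ∀ n, 1 ≤ n → 0 < rowSD P X n := fun n hn => by
    refine Real.sqrt_pos.2 (lt_of_lt_of_le ?_ (hR n))
    have : (0 : ℝ) < n := by exact_mod_cast hn
    positivity
  have hs2 : ∀ n, rowSD P X n ^ 2 = rowVar P X n := fun n =>
    Real.sq_sqrt ((by positivity : (0 : ℝ) ≤ n * v₀).trans (hR n))
  have hsum : ∀ n, ∑ i ∈ Finset.Icc 1 n, ∫ x, x ^ 2 ∂(ν n i) = rowSD P X n ^ 2 := fun n => by
    rw [hs2]; exact Finset.sum_congr rfl (hvar n)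
  refine ⟨fun n hn => ?_, ?_⟩
  · have h := isDensityOf_iterConv (hX_meas n) (hX_indep n) (hf n) hn le_rfl
    exact ⟨h, h.div_const (hs n hn) (Finset.measurable_sum _ fun i hi => hX_meas n i hi)⟩
  -- `p` is both the number of factors kept for integrability and the Hölder exponent. Since `p ≤ lᵤ
  -- n`, these factors are disjoint from those beyond `lᵤ n`.
  set p : ℕ := 2 * ⌈r / (r - 1)⌉₊ with hpdef
  have hrr : 0 < r / (r - 1) := div_pos (by linarith) (by linarith)
  have hp0 : 1 ≤ p := by
    have := Nat.ceil_pos.2 hrr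
    omega
  have hp : 2 * (r / (r - 1)) ≤ (p : ℝ) := by
    rw [hpdef]; push_cast
    have := Nat.le_ceil (r / (r - 1))
    linarith
  set C := (p : ℝ) * (8 * Real.pi * (2 * M' ^ r) ^ (1 / (r - 1))) with hCdef
  have hint : ∀ n, p ≤ n → ∫⁻ t, ∏ i ∈ Finset.Icc 1 p, ‖charFun (ν n i) t‖ₑ ≤
      ENNReal.ofReal C := fun n hn => by
    have hmem : ∀ i ∈ Finset.Icc 1 p, i ∈ Finset.Icc 1 n := fun i hi => by
      rw [Finset.mem_Icc] at hi ⊢; omega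
    refine lintegral_prod_le_of_forall_lintegral_pow_le _ ⟨1, by simp [hp0]⟩ (fun i hi => ?_)
      (fun i hi => ?_)
    · have := (hν n i (hmem i hi)).isProbabilityMeasure
      exact measurable_charFun.enorm.aemeasurable
    · rw [Nat.card_Icc, Nat.add_sub_cancel]
      exact (hf n i (hmem i hi)).lintegral_norm_charFun_pow_le (hX_meas n i (hmem i hi)) hr₁ hr₂
        hM' (hfM' n i (hmem i hi)) hp
  set ψ : ℕ → ℝ → ℂ := fun n t => ∏ i ∈ Finset.Icc 1 n, charFun (ν n i) (t / rowSD P X n)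
    with hψdef
  have hψm : ∀ n, Measurable (ψ n) := fun n => by
    refine Finset.measurable_fun_prod _ fun i hi => ?_
    have := (hν n i hi).isProbabilityMeasure
    exact measurable_charFun.comp (measurable_id.div_const _)
  have hψpt : ∀ t : ℝ, Tendsto (fun n => ψ n t) atTop (𝓝 ((Real.exp (-t ^ 2 / 2) : ℝ) : ℂ)) := by
    intro t
    rw [Metric.tendsto_nhds]
    intro η hη
    have hε : ∃ ε : ℝ, 0 < ε ∧ |t| ^ 3 * ε / 6 + t ^ 4 / 4 * ε ^ 2 < η / 2 := by
      have hcont : Tendsto (fun ε : ℝ => |t| ^ 3 * ε / 6 + t ^ 4 / 4 * ε ^ 2) (𝓝[>] 0) (𝓝 0) := by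
        have : Continuous fun ε : ℝ => |t| ^ 3 * ε / 6 + t ^ 4 / 4 * ε ^ 2 := by fun_prop
        simpa using (this.tendsto 0).mono_left nhdsWithin_le_nhds
      obtain ⟨ε, h1, h2⟩ := ((hcont.eventually_lt_const (half_pos hη)).and
        self_mem_nhdsWithin).exists
      exact ⟨ε, h2, h1⟩
    obtain ⟨ε, hε, hεη⟩ := hε
    have hL := (hLindeberg ε hε).const_mul (t ^ 2 + t ^ 4 / 4)
    rw [mul_zero] at hL
    filter_upwards [hL.eventually_lt_const (half_pos hη), eventually_ge_atTop 1] with n h1 hn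
    have h2 := norm_prod_charFun_sub_exp_le (hν n) (hs n hn) (hsum n) hε t
    rw [Finset.sum_congr rfl fun i hi => htl n i hi (ε * rowSD P X n), hs2] at h2
    rw [dist_eq_norm]
    refine h2.trans_lt ?_
    linarith
  obtain ⟨hT, hdecay⟩ := tendsto_of_log_isLittleO hv₀ hc₀ hR hK (hlᵤ.mono fun n h => h.2) hc
  have hdom : ∀ᶠ n in atTop, ∀ t : ℝ, |t| ≤ rowSD P X n / K n →
      ‖ψ n t‖ ≤ Real.exp (-(δ / 8) * t ^ 2) := by
    filter_upwards [hK, hlₗ, ha, hb, eventually_ge_atTop 1] with n hKn hln han hbn hn t ht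
    have hJ : Finset.Icc (lₗ n) n ⊆ Finset.Icc 1 n := Finset.Icc_subset_Icc_left hln
    have hRpos : 0 < rowVar P X n := by rw [← hs2]; have := hs n hn; positivity
    have e1 : ∑ i ∈ Finset.Icc (lₗ n) n, ∫ x, x ^ 2 ∂(ν n i) =
        ∑ i ∈ Finset.Icc (lₗ n) n, variance (X n i) (P n) :=
      Finset.sum_congr rfl fun i hi => hvar n i (hJ hi)
    have e2 : ∑ i ∈ Finset.Icc (lₗ n) n, ∫ x in {x | K n < |x|}, x ^ 2 ∂(ν n i) =
        ∑ i ∈ Finset.Icc (lₗ n) n, tailSecondMoment (P n) (X n i) (K n) :=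
      Finset.sum_congr rfl fun i hi => htl n i (hJ hi) _
    rw [le_div_iff₀ hRpos] at han
    -- Condition (a) makes the denominator in (b) positive, so that quotient is not a default value.
    have hBpos : 0 < ∑ i ∈ Finset.Icc (lₗ n) n, variance (X n i) (P n) :=
      lt_of_lt_of_le (by positivity) han
    rw [div_le_iff₀ hBpos] at hbn
    refine norm_prod_charFun_le_exp (hν n) (hs n hn) hJ (by linarith) ?_ ?_ ht
    · rwa [e1, hs2]
    · rw [e1, e2]; linarith
  have htail : Tendsto (fun n => ∫⁻ t in {t | rowSD P X n / K n < |t|}, ‖ψ n t‖ₑ) atTop (𝓝 0) := by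
    have h0 := ENNReal.tendsto_ofReal (hdecay.mul_const C)
    rw [zero_mul, ENNReal.ofReal_zero] at h0
    refine tendsto_of_tendsto_of_tendsto_of_le_of_le' tendsto_const_nhds h0
      (Eventually.of_forall fun _ => zero_le) ?_
    filter_upwards [hK, hlᵤ] with n hKn hln
    have hn : 1 ≤ n := by omega
    have hsn := hs n hn
    -- `V` bounds every variance beyond `lᵤ n` by monotonicity, and `K n ≤ √V` turns `|t| > s_n / K
    -- n` into the frequency condition `1 ≤ |t / s_n| √V`.
    set V := max (variance (X n (lᵤ n)) (P n)) (K n ^ 2) with hVdef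
    have hKV : K n ≤ Real.sqrt V := Real.le_sqrt_of_sq_le (le_max_right _ _)
    have hV : 0 < V := lt_of_lt_of_le (by positivity) (le_max_right _ _)
    have hD : Finset.Icc (lᵤ n + 1) n ⊆ Finset.Icc 1 n := Finset.Icc_subset_Icc_left (by omega)
    have key := setLIntegral_prod_charFun_le (I := Finset.Icc 1 n) (ν := ν n) (hν n)
      (T := rowSD P X n / K n) (q := c₀ / V) hsn (A := Finset.Icc 1 p)
      (D := Finset.Icc (lᵤ n + 1) n) (Finset.Icc_subset_Icc_right (by omega)) hD
      (Finset.disjoint_left.2 fun i h1 h2 => by rw [Finset.mem_Icc] at h1 h2; omega) ?_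
      (hint n (by omega))
    · refine key.trans (ENNReal.ofReal_le_ofReal (le_of_eq ?_))
      have hcard : ((Finset.Icc (lᵤ n + 1) n).card : ℝ) = (n : ℝ) - lᵤ n := by
        rw [Nat.card_Icc, ← Nat.cast_sub hln.2]; congr 1; omega
      rw [hcard, ← mul_assoc]
      rfl
    · intro i hi t ht
      have hi' := hD hi
      rw [Finset.mem_Icc] at hi
      refine (hf n i hi').norm_charFun_le_one_sub (hX_meas n i hi') hr₁ hM' (hfM' n i hi') hV
        (hν n i hi').integrable_sq ?_ ?_
      · refine (hvar n i hi').le.trans (le_trans ?_ (le_max_left _ _))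
        exact hX_order n ⟨by omega, by omega⟩ ⟨by omega, hi.2⟩ (by omega)
      · rw [div_lt_iff₀ (by linarith)] at ht
        rw [abs_div, abs_of_pos hsn, div_mul_eq_mul_div, le_div_iff₀ hsn, one_mul]
        exact ht.le.trans (mul_le_mul_of_nonneg_left hKV (abs_nonneg t))
  have hE := tendsto_lintegral_enorm_sub_exp (by positivity : 0 < δ / 8) hψm hψpt hdom htail hT
  rw [EMetric.tendstoUniformly_iff]
  intro ε hε
  -- The strict inequality `p < n` puts the `p` integrable factors among the first `n - 1`.
  filter_upwards [hE.eventually_lt_const hε, eventually_gt_atTop p] with n hnε hn x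
  have hn1 : 1 ≤ n := by omega
  have hfin := (hint n hn.le).trans_lt ENNReal.ofReal_lt_top
  have hψi : Integrable (ψ n) :=
    (integrable_prod_charFun (fun i hi => (hν n i hi).isProbabilityMeasure)
      (Finset.Icc_subset_Icc_right hn.le) hfin).comp_div (hs n hn1).ne'
  have hgi : Integrable fun t : ℝ => ((Real.exp (-t ^ 2 / 2) : ℝ) : ℂ) := by
    have h := (integrable_exp_neg_mul_sq (b := 1 / 2) (by norm_num)).ofReal (𝕜 := ℂ)
    refine h.congr (ae_of_all _ fun t => ?_)
    simp only [Complex.coe_algebraMap]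
    congr 2; ring
  rw [edist_comm, edist_eq_enorm_sub]
  refine lt_of_le_of_lt ?_ hnε
  exact enorm_sub_le_lintegral_of_eq_integral hψi hgi
    (mul_iterConv_eq_integral (hX_meas n) (hX_indep n) (hf n) (by omega)
      (Finset.Icc_subset_Icc_right (by omega)) hfin (hs n hn1) x)
    (gaussian_density_eq_integral x)
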